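/- Let $\mathbb{U}$ be the open unit disc and let $H^2$ be the Hilbert space of functions $f(z)=\sum_{n\ge 0}\hat f(n)z^n$ holomorphic on $\mathbb{U}$ with $\|f\|^2=\sum_{n\ge0}|\hat f(n)|^2<\infty$; let $H^2_0=\{f\in H^2: f(0)=0\}$ with the same norm. For $f\in H^2$ let $(Bf)(z)=(f(z)-f(0))/z$ for $z\in\mathbb{U}\setminus\{0\}$ and $(Bf)(0)=f'(0)$ (the backward shift). Let $\varphi$ be a rational function with $\varphi(\mathbb{U})\subset\mathbb{U}$, and let $\varphi_e=\rho\circ\varphi\circ\rho$ on the Riemann sphere, where $\rho(z)=1/\overline{z}$. Then $\varphi_e$ is a rational map of the sphere; let $d$ be its degree (the larger of the degrees of numerator and denominator in lowest terms). A point $z$ is called a regular value of $\varphi_e$ if $\varphi_e^{-1}(\{z\})$ consists of exactly $d$ distinct points. The composition operator $C_\varphi f=f\circ\varphi$ is bounded on $H^2$; let $C_\varphi^*$ be its adjoint. For $f\in H^2_0$ let $\Omega_\varphi f$ be the holomorphic function on $\mathbb{U}$ determined by $C_\varphi^*f(z)=z\,\Omega_\varphi f(z)$ for all $z\in\mathbb{U}$.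 Then: (a) $\Omega_\varphi$ is a bounded linear operator from $H^2_0$ into $H^2$. (b) If $z\in\mathbb{U}$ is a regular value of $\varphi_e$, then there are a connected open neighbourhood $V\subset\mathbb{U}$ of $z$ and $d$ distinct holomorphic branches $\sigma_1,\dots,\sigma_d$ of $\varphi_e^{-1}$ on $V$ (that is, $\varphi_e(\sigma_j(w))=w$ for $w\in V$), and for every such choice of $V$ and $\sigma_1,\dots,\sigma_d$ and every $f\in H^2_0$, $$\Omega_\varphi f(z)=\sum_{j=1}^d\sigma_j'(z)\,(Bf)(\sigma_j(z)).$$ -/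

import Mathlib

open scoped ENNReal

/-! Notions for composition operators with rational symbol on the Hardy space of the disc. -/

namespace RationalComposition

/-! ### The Hardy space -/

/-- The open unit disc. -/
def unitDisc : Set ℂ := Metric.ball 0 1

/-- The `n`-th Maclaurin coefficient of `f`. -/
noncomputable def maclaurinCoeff (f : ℂ → ℂ) (n : ℕ) : ℂ :=
  iteratedDeriv n f 0 / (n.factorial : ℂ)

/-- The functions holomorphic on the unit disc with square-summable Maclaurin coefficients.
A function on the disc is represented by its extension by zero to the plane, so that two
elements are equal exactly when they agree on the disc. -/
def IsHardy (f : ℂ → ℂ) : Prop :=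
  DifferentiableOn ℂ f unitDisc ∧ (∀ z, z ∉ unitDisc → f z = 0) ∧
    Summable fun n => ‖maclaurinCoeff f n‖ ^ 2

theorem isOpen_unitDisc : IsOpen unitDisc := Metric.isOpen_ball

theorem zero_mem_unitDisc : (0 : ℂ) ∈ unitDisc := by simp [unitDisc]

theorem contDiffAt_zero_of_differentiableOn {f : ℂ → ℂ} (hf : DifferentiableOn ℂ f unitDisc)
    (n : ℕ) : ContDiffAt ℂ n f 0 :=
  ((hf.analyticOnNhd isOpen_unitDisc) 0 zero_mem_unitDisc).contDiffAt

theorem maclaurinCoeff_add {f g : ℂ → ℂ} (hf : DifferentiableOn ℂ f unitDisc)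
    (hg : DifferentiableOn ℂ g unitDisc) (n : ℕ) :
    maclaurinCoeff (f + g) n = maclaurinCoeff f n + maclaurinCoeff g n := by
  simp only [maclaurinCoeff]
  rw [iteratedDeriv_add (contDiffAt_zero_of_differentiableOn hf n)
    (contDiffAt_zero_of_differentiableOn hg n), add_div]

theorem maclaurinCoeff_smul (c : ℂ) (f : ℂ → ℂ) (n : ℕ) :
    maclaurinCoeff (c • f) n = c * maclaurinCoeff f n := by
  simp only [maclaurinCoeff]
  rw [iteratedDeriv_const_smul_field, smul_eq_mul, mul_div_assoc]

theorem memℓp_two_iff {a : ℕ → ℂ} : Memℓp a 2 ↔ Summable fun n => ‖a n‖ ^ 2 := by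
  rw [memℓp_gen_iff (by norm_num)]
  norm_num

theorem IsHardy.memℓp {f : ℂ → ℂ} (hf : IsHardy f) : Memℓp (maclaurinCoeff f) 2 :=
  memℓp_two_iff.2 hf.2.2

/-- The linear space of `H²` functions. -/
def hardySubmodule : Submodule ℂ (ℂ → ℂ) where
  carrier := {f | IsHardy f}
  zero_mem' := by
    refine ⟨differentiableOn_const 0, fun _ _ => rfl, ?_⟩
    simp [maclaurinCoeff, summable_zero]
  add_mem' := by
    intro f g hf hg
    refine ⟨hf.1.add hg.1, fun z hz => by simp [hf.2.1 z hz, hg.2.1 z hz], ?_⟩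
    have h : maclaurinCoeff (f + g) = maclaurinCoeff f + maclaurinCoeff g :=
      funext (maclaurinCoeff_add hf.1 hg.1)
    rw [← memℓp_two_iff (a := maclaurinCoeff (f + g)), h]
    exact hf.memℓp.add hg.memℓp
  smul_mem' := by
    intro c f hf
    refine ⟨hf.1.const_smul c, fun z hz => by simp [hf.2.1 z hz], ?_⟩
    have h : maclaurinCoeff (c • f) = c • maclaurinCoeff f :=
      funext (maclaurinCoeff_smul c f)
    rw [← memℓp_two_iff (a := maclaurinCoeff (c • f)), h]
    exact hf.memℓp.const_smul c

/-- The Hardy space `H²`. It is a type of its own, so that its topology is the one of the norm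
below and not the topology of pointwise convergence. -/
def H2 : Type := hardySubmodule

namespace H2

instance : AddCommGroup H2 := inferInstanceAs (AddCommGroup hardySubmodule)

instance : Module ℂ H2 := inferInstanceAs (Module ℂ hardySubmodule)

instance : CoeFun H2 fun _ => ℂ → ℂ := ⟨fun f => f.1⟩

theorem isHardy (f : H2) : IsHardy f := f.2

theorem add_apply (f g : H2) (z : ℂ) : (f + g) z = f z + g z := rfl

theorem smul_apply (c : ℂ) (f : H2) (z : ℂ) : (c • f) z = c * f z := rfl

/-- The sequence of Maclaurin coefficients, as a linear map into `ℓ²`. -/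
noncomputable def coeffs : H2 →ₗ[ℂ] lp (fun _ : ℕ => ℂ) 2 where
  toFun f := ⟨maclaurinCoeff f, f.isHardy.memℓp⟩
  map_add' f g := by
    ext n
    exact maclaurinCoeff_add f.isHardy.1 g.isHardy.1 n
  map_smul' c f := by
    ext n
    exact maclaurinCoeff_smul c f n

theorem coeffs_apply (f : H2) (n : ℕ) : coeffs f n = maclaurinCoeff f n := rfl

theorem apply_eq_tsum (f : H2) {z : ℂ} (hz : z ∈ unitDisc) :
    f z = ∑' n : ℕ, maclaurinCoeff f n * z ^ n := by
  have h := Complex.taylorSeries_eq_on_ball' (c := 0) (r := 1) (z := z) hz f.isHardy.1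
  rw [← h]
  refine tsum_congr fun n => ?_
  rw [maclaurinCoeff, sub_zero, div_eq_inv_mul]

theorem coeffs_injective : Function.Injective coeffs := by
  intro f g h
  refine Subtype.ext (funext fun z => ?_)
  by_cases hz : z ∈ unitDisc
  · have h' : ∀ n, maclaurinCoeff f n = maclaurinCoeff g n := fun n => by
      rw [← coeffs_apply, h, coeffs_apply]
    change f z = g z
    rw [apply_eq_tsum f hz, apply_eq_tsum g hz]
    simp only [h']
  · exact (f.isHardy.2.1 z hz).trans (g.isHardy.2.1 z hz).symm

theorem coeffs_surjective : Function.Surjective coeffs := by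
  intro a
  have hbd : ∀ n, ‖a n‖ ≤ ‖a‖ := fun n => lp.norm_apply_le_norm (by norm_num) a n
  set p := FormalMultilinearSeries.ofScalars ℂ (fun n => a n) with hp
  have hrad : (1 : ℝ≥0∞) ≤ p.radius := by
    refine p.le_radius_of_bound (r := 1) ‖a‖ fun n => ?_
    rw [hp, FormalMultilinearSeries.ofScalars_norm]
    simpa using hbd n
  have hs := (p.hasFPowerSeriesOnBall (lt_of_lt_of_le one_pos hrad)).mono one_pos hrad
  have hball : Metric.eball (0 : ℂ) 1 = unitDisc := by
    rw [unitDisc, ← Metric.eball_ofReal, ENNReal.ofReal_one]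
  have hF : HasFPowerSeriesOnBall (unitDisc.indicator p.sum) p 0 1 := by
    refine hs.congr fun z hz => ?_
    rw [hball] at hz
    rw [Set.indicator_of_mem hz]
  have hc : maclaurinCoeff (unitDisc.indicator p.sum) = fun n => a n := by
    have h1 := hF.analyticAt.hasFPowerSeriesAt.eq_formalMultilinearSeries hF.hasFPowerSeriesAt
    exact FormalMultilinearSeries.ofScalars_series_injective ℂ ℂ h1
  have hH : IsHardy (unitDisc.indicator p.sum) := by
    refine ⟨?_, fun z hz => Set.indicator_of_notMem hz _, ?_⟩
    · have h2 := hF.differentiableOn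
      rwa [hball] at h2
    · rw [hc]
      exact memℓp_two_iff.1 a.2
  refine ⟨⟨_, hH⟩, ?_⟩
  ext n
  exact congrFun hc n

noncomputable instance : NormedAddCommGroup H2 :=
  NormedAddCommGroup.induced H2 (lp (fun _ : ℕ => ℂ) 2) coeffs coeffs_injective

noncomputable instance : InnerProductSpace ℂ H2 where
  inner f g := inner ℂ (coeffs f) (coeffs g)
  norm_smul_le c f := by
    change ‖coeffs (c • f)‖ ≤ ‖c‖ * ‖coeffs f‖
    rw [map_smul]
    exact norm_smul_le _ _
  norm_sq_eq_re_inner f := norm_sq_eq_re_inner (coeffs f)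
  conj_inner_symm f g := inner_conj_symm (coeffs f) (coeffs g)
  add_left f g h := by rw [map_add]; exact inner_add_left _ _ _
  smul_left f g c := by rw [map_smul]; exact inner_smul_left _ _ _

/-- The inner product of `H²`; Mathlib's inner product is conjugate-linear in its first
argument. -/
theorem inner_eq_tsum (f g : H2) :
    inner ℂ f g = ∑' n, starRingEnd ℂ (maclaurinCoeff f n) * maclaurinCoeff g n := by
  change inner ℂ (coeffs f) (coeffs g) = _
  rw [lp.inner_eq_tsum]
  refine tsum_congr fun n => ?_
  rw [coeffs_apply, coeffs_apply, RCLike.inner_apply, mul_comm]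

/-- The norm of `H²`. -/
theorem norm_sq_eq_tsum (f : H2) : ‖f‖ ^ 2 = ∑' n, ‖maclaurinCoeff f n‖ ^ 2 := by
  have h := lp.norm_rpow_eq_tsum (p := 2) (by norm_num) (coeffs f)
  simp only [ENNReal.toReal_ofNat, Real.rpow_ofNat] at h
  exact h

/-- `H²` is isometrically isomorphic to `ℓ²` through the Maclaurin coefficients. -/
noncomputable def coeffsEquiv : H2 ≃ₗᵢ[ℂ] lp (fun _ : ℕ => ℂ) 2 where
  toLinearEquiv := LinearEquiv.ofBijective coeffs ⟨coeffs_injective, coeffs_surjective⟩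
  norm_map' _ := rfl

instance : CompleteSpace H2 := coeffsEquiv.toIsometryEquiv.completeSpace

end H2

/-- The subspace `H²₀` of the functions in `H²` that vanish at the origin, with the norm
of `H²`. -/
def H20 : Submodule ℂ H2 where
  carrier := {f | f 0 = 0}
  zero_mem' := rfl
  add_mem' := by
    intro f g hf hg
    change f 0 + g 0 = 0
    rw [show f 0 = 0 from hf, show g 0 = 0 from hg, add_zero]
  smul_mem' := by
    intro c f hf
    change c * f 0 = 0
    rw [show f 0 = 0 from hf, mul_zero]

/-- The backward shift. -/
noncomputable def backwardShift (f : ℂ → ℂ) (z : ℂ) : ℂ :=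
  if z = 0 then deriv f 0 else (f z - f 0) / z

/-! ### Rational maps of the Riemann sphere -/

/-- The self-map of the Riemann sphere induced by the quotient `p / q` of relatively prime
polynomials. At `∞` its value is the ratio of the coefficients of degree
`d = max (deg p) (deg q)`. The pair `(1, 0)` gives the constant map `∞`. -/
noncomputable def sphereMap (p q : Polynomial ℂ) : OnePoint ℂ → OnePoint ℂ
  | OnePoint.infty =>
      if q.coeff (max p.natDegree q.natDegree) = 0 then OnePoint.infty
      else ((p.coeff (max p.natDegree q.natDegree) /
        q.coeff (max p.natDegree q.natDegree) : ℂ) : OnePoint ℂ)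
  | OnePoint.some z =>
      if q.eval z = 0 then OnePoint.infty else ((p.eval z / q.eval z : ℂ) : OnePoint ℂ)

/-- `R` is a rational self-map of the Riemann sphere, of degree `d`. -/
def IsRationalOfDegree (R : OnePoint ℂ → OnePoint ℂ) (d : ℕ) : Prop :=
  ∃ p q : Polynomial ℂ, IsCoprime p q ∧ R = sphereMap p q ∧ max p.natDegree q.natDegree = d

/-- `w` is a regular value of the rational map `R`: the number of distinct points in the
preimage of `w` is the degree of `R`. -/
def IsRegularValue (R : OnePoint ℂ → OnePoint ℂ) (w : OnePoint ℂ) : Prop :=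
  ∃ d, IsRationalOfDegree R d ∧ (R ⁻¹' {w}).encard = d

/-- Inversion `z ↦ 1 / conj z` in the unit circle, on the Riemann sphere. -/
noncomputable def inversion : OnePoint ℂ → OnePoint ℂ
  | OnePoint.infty => ((0 : ℂ) : OnePoint ℂ)
  | OnePoint.some z => if z = 0 then OnePoint.infty else ((1 / starRingEnd ℂ z : ℂ) : OnePoint ℂ)

/-- The value of a rational function at a point of the plane (meaningful off its poles). -/
noncomputable def evalAt (φ : RatFunc ℂ) (z : ℂ) : ℂ := φ.eval (RingHom.id ℂ) z

/-- The rational function `φ` maps the open unit disc into itself; in particular it has no poles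
there. -/
def IsSelfMap (φ : RatFunc ℂ) : Prop :=
  ∀ z ∈ unitDisc, φ.denom.eval z ≠ 0 ∧ evalAt φ z ∈ unitDisc

/-- The exterior map `φₑ = ρ ∘ φ ∘ ρ`, where `ρ` is inversion in the unit circle. -/
noncomputable def exteriorMap (φ : RatFunc ℂ) : OnePoint ℂ → OnePoint ℂ :=
  inversion ∘ sphereMap φ.num φ.denom ∘ inversion

/-- `σ` is a holomorphic branch of `R⁻¹` on the set `V`. -/
def IsBranch (R : OnePoint ℂ → OnePoint ℂ) (V : Set ℂ) (σ : ℂ → ℂ) : Prop :=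
  DifferentiableOn ℂ σ V ∧ ∀ z ∈ V, R (σ z : OnePoint ℂ) = (z : OnePoint ℂ)

/-- `V` is a connected open neighbourhood of `z` in the unit disc, and the `σ j` are `d` distinct
branches of `R⁻¹` on `V`. -/
structure IsBranchSystem (R : OnePoint ℂ → OnePoint ℂ) (d : ℕ) (z : ℂ) (V : Set ℂ)
    (σ : Fin d → ℂ → ℂ) : Prop where
  isOpen : IsOpen V
  isConnected : IsConnected V
  subset : V ⊆ unitDisc
  mem : z ∈ V
  branch : ∀ j, IsBranch R V (σ j)
  distinct : ∀ i j, i ≠ j → ¬ Set.EqOn (σ i) (σ j) V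

end RationalComposition

open RationalComposition

namespace RationalComposition

open Real Metric

/-! ### Circle averages of power series -/

/-! The functional `g ↦ (Bg)(z)` on `H²` is represented by `k_z(u) = u / (1 - conj z * u)`. Since `C
1 = 1`, the adjoint `C*` preserves values at `0`. Hence `C* f` vanishes at `0` when `f` does, `Ω` is
`B C*` restricted to `H20`, and `Ω f z = ⟨k_z, C* f⟩ = ⟨C k_z, f⟩`.

Now `C k_z = num / (denom - conj z * num)` is rational. Reflecting in the unit circle turns its
denominator into `fiberPoly φ z`, whose roots are the preimages of `z` under the exterior map. At a
regular value there are `d` of them, all simple, and they lie in the disc because `|num| ≤ |denom|`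
on the closed disc. Partial fractions (`eval_div_eval_eq`, `IsSelfMap.num_div_eq`) give `C k_z =
const + ∑ conj (c_j) k_{s_j}`, and implicit differentiation (`IsSelfMap.deriv_branch`) identifies
`c_j` with `σ_j'(z)`. Pairing with `f` kills the constant, as `f 0 = 0`, and leaves the formula.

Boundedness of `C` is Littlewood's subordination principle: `|f|²` lies below its Poisson integral,
whose composite with `φ` is harmonic, so circle means of `|f ∘ φ|²` are controlled by the Poisson
integral at `φ 0` (`circleAverage_sq_comp_le`). Parseval on circles turns this into a bound on
coefficients. -/

theorem mem_unitDisc {z : ℂ} : z ∈ unitDisc ↔ ‖z‖ < 1 := by simp [unitDisc]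

/-- Termwise integration by dominated convergence. With `g` a conjugate monomial it extracts a
coefficient; with `g` the conjugate of `F` it gives Parseval. -/
theorem hasSum_circleAverage_mul {a : ℕ → ℂ} {F g : ℂ → ℂ} {r : ℝ} (hr : 0 ≤ r)
    (ha : Summable fun n => ‖a n‖ * r ^ n)
    (hF : ∀ u ∈ sphere (0 : ℂ) r, HasSum (fun n => a n * u ^ n) (F u))
    (hg : ContinuousOn g (sphere 0 r)) :
    HasSum (fun n => a n * circleAverage (fun u => u ^ n * g u) 0 r)
      (circleAverage (fun u => F u * g u) 0 r) := by
  have hmem : ∀ t : ℝ, circleMap 0 r t ∈ sphere (0 : ℂ) r := fun t => circleMap_mem_sphere 0 hr t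
  have hgc : Continuous fun t : ℝ => g (circleMap 0 r t) :=
    hg.comp_continuous (continuous_circleMap 0 r) hmem
  have key : HasSum (fun n => ∫ t in (0 : ℝ)..2 * π,
        a n * ((circleMap 0 r t) ^ n * g (circleMap 0 r t)))
      (∫ t in (0 : ℝ)..2 * π, F (circleMap 0 r t) * g (circleMap 0 r t)) := by
    refine intervalIntegral.hasSum_integral_of_dominated_convergence
      (fun n t => ‖a n‖ * r ^ n * ‖g (circleMap 0 r t)‖) (fun n => ?_) (fun n => ?_) ?_ ?_ ?_
    · exact (continuous_const.mul
        (((continuous_circleMap 0 r).pow n).mul hgc)).aestronglyMeasurable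
    · refine Filter.Eventually.of_forall fun t _ => ?_
      rw [norm_mul, norm_mul, norm_pow, norm_circleMap_zero, abs_of_nonneg hr, mul_assoc]
    · exact Filter.Eventually.of_forall fun t _ => ha.mul_right _
    · simp_rw [tsum_mul_right]
      exact (continuous_const.mul hgc.norm).intervalIntegrable _ _
    · refine Filter.Eventually.of_forall fun t _ => ?_
      simpa only [mul_assoc] using (hF _ (hmem t)).mul_right (g (circleMap 0 r t))
  have h2 := key.const_smul ((2 * π)⁻¹ : ℝ)
  simp only [circleAverage_def]
  convert h2 using 2 with n
  rw [intervalIntegral.integral_const_mul, mul_smul_comm]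

theorem circleAverage_conj {F : ℂ → ℂ} {r : ℝ} (hr : 0 ≤ r) (hF : ContinuousOn F (sphere 0 r)) :
    circleAverage (fun u => starRingEnd ℂ (F u)) 0 r = starRingEnd ℂ (circleAverage F 0 r) :=
  (Complex.conjCLE : ℂ →L[ℝ] ℂ).circleAverage_comp_comm (hF.circleIntegrable hr)

/-- On the circle `u * conj u = r²`, so the integrand agrees there with the polynomial `r ^ (2n) * u
^ (m - n)`, and its mean is the value at `0`. -/
theorem circleAverage_pow_mul_conj_pow_of_le {m n : ℕ} {r : ℝ} (hr : 0 ≤ r) (h : n ≤ m) :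
    circleAverage (fun u : ℂ => u ^ m * starRingEnd ℂ (u ^ n)) 0 r
      = if m = n then (r : ℂ) ^ (2 * n) else 0 := by
  have h1 : Set.EqOn (fun u : ℂ => u ^ m * starRingEnd ℂ (u ^ n))
      (fun u => (r : ℂ) ^ (2 * n) * u ^ (m - n)) (sphere 0 |r|) := by
    intro u hu
    have hu' : ‖u‖ = r := by simpa [abs_of_nonneg hr] using hu
    have h2 : u * starRingEnd ℂ u = (r : ℂ) ^ 2 := by rw [Complex.mul_conj', hu']
    obtain ⟨k, rfl⟩ := Nat.exists_eq_add_of_le h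
    simp only [map_pow, Nat.add_sub_cancel_left]
    rw [pow_mul, ← h2, mul_pow, pow_add]
    ring
  rw [circleAverage_congr_sphere h1, DiffContOnCl.circleAverage]
  · rcases eq_or_lt_of_le h with rfl | hlt
    · simp
    · rw [zero_pow (by lia), if_neg (by lia), mul_zero]
  · exact Differentiable.diffContOnCl (by fun_prop)

theorem circleAverage_pow_mul_conj_pow {m n : ℕ} {r : ℝ} (hr : 0 ≤ r) :
    circleAverage (fun u : ℂ => u ^ m * starRingEnd ℂ (u ^ n)) 0 r
      = if m = n then (r : ℂ) ^ (2 * n) else 0 := by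
  rcases le_total n m with h | h
  · exact circleAverage_pow_mul_conj_pow_of_le hr h
  · have h1 := circleAverage_conj (F := fun u : ℂ => u ^ n * starRingEnd ℂ (u ^ m)) hr
      (by fun_prop)
    rw [circleAverage_pow_mul_conj_pow_of_le hr h] at h1
    simp only [map_mul, Complex.conj_conj] at h1
    simp only [mul_comm (_ ^ m)]
    rw [h1]
    by_cases hmn : n = m
    · subst hmn; simp
    · simp [hmn, Ne.symm hmn]

theorem hasSum_maclaurinCoeff {f : ℂ → ℂ} (hf : DifferentiableOn ℂ f unitDisc) {z : ℂ}
    (hz : z ∈ unitDisc) : HasSum (fun n => maclaurinCoeff f n * z ^ n) (f z) := by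
  have h := Complex.hasSum_taylorSeries_on_ball hf hz
  have h1 : (fun n => maclaurinCoeff f n * z ^ n) =
      fun n : ℕ => ((n.factorial : ℂ))⁻¹ • (z - 0) ^ n • iteratedDeriv n f 0 := by
    funext n
    rw [maclaurinCoeff, sub_zero, smul_eq_mul, smul_eq_mul, div_eq_inv_mul]
    ring
  rw [h1]
  exact h

theorem sphere_subset_unitDisc {r : ℝ} (hr : r < 1) : sphere (0 : ℂ) r ⊆ unitDisc := by
  intro u hu
  rw [mem_sphere_zero_iff_norm] at hu
  exact mem_unitDisc.2 (hu ▸ hr)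

theorem summable_norm_maclaurinCoeff {f : ℂ → ℂ} (hf : DifferentiableOn ℂ f unitDisc) {r : ℝ}
    (hr : 0 ≤ r) (hr1 : r < 1) : Summable fun n => ‖maclaurinCoeff f n‖ * r ^ n := by
  have h := (hasSum_maclaurinCoeff hf (z := (r : ℂ))
    (mem_unitDisc.2 (by simpa [abs_of_nonneg hr] using hr1))).summable.norm
  simpa [abs_of_nonneg hr] using h

/-- Parseval's identity on a circle. -/
theorem hasSum_sq_maclaurinCoeff {f : ℂ → ℂ} (hf : DifferentiableOn ℂ f unitDisc) {r : ℝ}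
    (hr : 0 ≤ r) (hr1 : r < 1) :
    HasSum (fun n => ‖maclaurinCoeff f n‖ ^ 2 * r ^ (2 * n))
      (circleAverage (fun u => ‖f u‖ ^ 2) 0 r) := by
  have hs := sphere_subset_unitDisc hr1
  have hc : ContinuousOn f (sphere 0 r) := hf.continuousOn.mono hs
  have ha := summable_norm_maclaurinCoeff hf hr hr1
  have hF : ∀ u ∈ sphere (0 : ℂ) r, HasSum (fun n => maclaurinCoeff f n * u ^ n) (f u) :=
    fun u hu => hasSum_maclaurinCoeff hf (hs hu)
  have hcoef : ∀ n : ℕ, circleAverage (fun u => f u * starRingEnd ℂ (u ^ n)) 0 r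
      = maclaurinCoeff f n * (r : ℂ) ^ (2 * n) := fun n => by
    have h1 := hasSum_circleAverage_mul (g := fun u => starRingEnd ℂ (u ^ n)) hr ha hF
      (by fun_prop)
    simp only [circleAverage_pow_mul_conj_pow hr] at h1
    refine h1.unique ?_
    convert hasSum_ite_eq n (maclaurinCoeff f n * (r : ℂ) ^ (2 * n)) using 2 with m
    by_cases hmn : m = n
    · subst hmn; simp
    · simp [hmn]
  have h2 := hasSum_circleAverage_mul (g := fun u => starRingEnd ℂ (f u)) hr ha hF
    (Complex.continuous_conj.comp_continuousOn hc)
  have h3 : ∀ n : ℕ, circleAverage (fun u => u ^ n * starRingEnd ℂ (f u)) 0 r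
      = starRingEnd ℂ (maclaurinCoeff f n) * (r : ℂ) ^ (2 * n) := fun n => by
    have h4 := circleAverage_conj (F := fun u => f u * starRingEnd ℂ (u ^ n)) hr
      (hc.mul (by fun_prop))
    rw [hcoef] at h4
    simp only [map_mul, Complex.conj_conj, map_pow, Complex.conj_ofReal] at h4
    rw [← h4]
    simp only [mul_comm]
  simp only [h3] at h2
  have h5 : circleAverage (fun u => f u * starRingEnd ℂ (f u)) 0 r
      = ((circleAverage (fun u => ‖f u‖ ^ 2) 0 r : ℝ) : ℂ) := by
    have h6 := Complex.ofRealCLM.circleAverage_comp_comm (f := fun u => ‖f u‖ ^ 2) (c := 0) (R := r)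
      ((hc.norm.pow 2).circleIntegrable hr)
    rw [Complex.ofRealCLM_apply] at h6
    rw [← h6]
    congr 1
    funext u
    simp [Complex.mul_conj']
  rw [h5] at h2
  refine Complex.hasSum_ofReal.1 ?_
  convert h2 using 2 with n
  push_cast
  rw [← mul_assoc, Complex.mul_conj']

/-! ### Boundedness of composition operators -/

theorem continuousOn_poissonKernel_sphere {w : ℂ} {ρ : ℝ} (hρ : 0 ≤ ρ) (hw : w ∈ ball 0 ρ) :
    ContinuousOn (poissonKernel 0 w) (sphere 0 ρ) := by
  rw [poissonKernel_eq_re_herglotzRieszKernel]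
  refine Complex.continuous_re.comp_continuousOn ?_
  simpa [abs_of_nonneg hρ] using continuousOn_herglotzRieszKernel_sphere hw

theorem diffContOnCl_ball {f : ℂ → ℂ} (hf : DifferentiableOn ℂ f unitDisc) {ρ : ℝ}
    (hρ1 : ρ < 1) : DiffContOnCl ℂ f (ball 0 ρ) :=
  DifferentiableOn.diffContOnCl
    (hf.mono (closure_ball_subset_closedBall.trans (closedBall_subset_ball hρ1)))

/-- The square of the modulus of a holomorphic function lies below its Poisson integral. -/
theorem sq_norm_le_poisson {f : ℂ → ℂ} (hf : DifferentiableOn ℂ f unitDisc) {ρ : ℝ}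
    (hρ : 0 < ρ) (hρ1 : ρ < 1) {w : ℂ} (hw : w ∈ ball 0 ρ) :
    ‖f w‖ ^ 2 ≤ circleAverage (fun u => poissonKernel 0 w u * ‖f u‖ ^ 2) 0 ρ := by
  have hP := continuousOn_poissonKernel_sphere hρ.le hw
  have hfc : ContinuousOn f (sphere 0 ρ) := hf.continuousOn.mono (sphere_subset_unitDisc hρ1)
  -- The Poisson kernel reproduces the constant `1`, so it is a probability density.
  have h1 : circleAverage (fun u => poissonKernel 0 w u) 0 ρ = 1 := by
    have h := DiffContOnCl.circleAverage_poissonKernel_smul (f := fun _ : ℂ => (1 : ℂ))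
      (diffContOnCl_const (s := ball (0 : ℂ) ρ)) hw
    have h6 := Complex.ofRealCLM.circleAverage_comp_comm (hP.circleIntegrable hρ.le)
    have h7 : (poissonKernel 0 w • fun _ : ℂ => (1 : ℂ)) =
        Complex.ofRealCLM ∘ poissonKernel 0 w := by
      funext u; simp
    rw [h7, h6, Complex.ofRealCLM_apply] at h
    exact_mod_cast h
  have h2 : circleAverage (fun u => poissonKernel 0 w u * (starRingEnd ℂ (f w) * f u).re) 0 ρ
      = ‖f w‖ ^ 2 := by
    have h := DiffContOnCl.circleAverage_poissonKernel_smul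
      (f := fun u => starRingEnd ℂ (f w) * f u)
      ((diffContOnCl_ball hf hρ1).const_smul (starRingEnd ℂ (f w))) hw
    have h6 := Complex.reCLM.circleAverage_comp_comm
      (f := poissonKernel 0 w • fun u => starRingEnd ℂ (f w) * f u)
      (ContinuousOn.circleIntegrable hρ.le (hP.smul (continuousOn_const.mul hfc)))
    rw [h, Complex.conj_mul'] at h6
    simp only [Complex.reCLM_apply, ← Complex.ofReal_pow, Complex.ofReal_re] at h6
    rw [← h6]
    congr 1
    funext u
    simp
  have hPn : ∀ u ∈ sphere (0 : ℂ) |ρ|, 0 ≤ poissonKernel 0 w u := by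
    intro u hu
    rw [abs_of_pos hρ, mem_sphere_zero_iff_norm] at hu
    rw [mem_ball_zero_iff] at hw
    rw [poissonKernel_def, sub_zero, sub_zero, hu]
    have : 0 ≤ ρ ^ 2 - ‖w‖ ^ 2 := by nlinarith [norm_nonneg w]
    positivity
  -- A variance argument: the Poisson mean of `|f - f w|²` is nonnegative, and expanding it with
  -- `h1` and `h2` gives the claim.
  have h3 : 0 ≤ circleAverage (fun u => poissonKernel 0 w u * ‖f u - f w‖ ^ 2) 0 ρ :=
    circleAverage_nonneg_of_nonneg fun u hu => mul_nonneg (hPn u hu) (sq_nonneg _)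
  have h4 : (fun u => poissonKernel 0 w u * ‖f u - f w‖ ^ 2) = fun u =>
      poissonKernel 0 w u * ‖f u‖ ^ 2 + ‖f w‖ ^ 2 • poissonKernel 0 w u
        - (2 : ℝ) • (poissonKernel 0 w u * (starRingEnd ℂ (f w) * f u).re) := by
    funext u
    rw [← Complex.normSq_eq_norm_sq, Complex.normSq_sub, Complex.normSq_eq_norm_sq,
      Complex.normSq_eq_norm_sq, smul_eq_mul, smul_eq_mul, mul_comm (f u)]
    ring
  have i1 : CircleIntegrable (fun u => poissonKernel 0 w u * ‖f u‖ ^ 2) 0 ρ :=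
    ContinuousOn.circleIntegrable hρ.le (hP.mul (hfc.norm.pow 2))
  have i2 : CircleIntegrable (fun u => ‖f w‖ ^ 2 • poissonKernel 0 w u) 0 ρ :=
    ContinuousOn.circleIntegrable hρ.le (continuousOn_const.mul hP)
  have i3 : CircleIntegrable
      (fun u => (2 : ℝ) • (poissonKernel 0 w u * (starRingEnd ℂ (f w) * f u).re)) 0 ρ :=
    ContinuousOn.circleIntegrable hρ.le (continuousOn_const.mul (hP.mul
      (Complex.continuous_re.comp_continuousOn (continuousOn_const.mul hfc))))
  have i4 : CircleIntegrable (fun u => poissonKernel 0 w u * ‖f u‖ ^ 2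
      + ‖f w‖ ^ 2 • poissonKernel 0 w u) 0 ρ := i1.add i2
  rw [h4, circleAverage_fun_sub i4 i3, circleAverage_fun_add i1 i2,
    circleAverage_fun_smul, circleAverage_fun_smul, h1, h2, smul_eq_mul, smul_eq_mul] at h3
  linarith

/-- Littlewood's subordination inequality on circles, by harmonic majorants. -/
theorem circleAverage_sq_comp_le {f φ : ℂ → ℂ} (hf : DifferentiableOn ℂ f unitDisc)
    (hφ : DifferentiableOn ℂ φ unitDisc) {r ρ : ℝ} (hr : 0 ≤ r) (hr1 : r < 1) (hρ1 : ρ < 1)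
    (hmap : ∀ u ∈ closedBall (0 : ℂ) r, φ u ∈ ball 0 ρ) :
    circleAverage (fun u => ‖f (φ u)‖ ^ 2) 0 r
      ≤ (ρ + ‖φ 0‖) / (ρ - ‖φ 0‖) * circleAverage (fun u => ‖f u‖ ^ 2) 0 ρ := by
  have h0 : φ 0 ∈ ball 0 ρ := hmap 0 (by simpa using hr)
  have hρ : 0 < ρ := pos_of_mem_ball h0
  have hfc : ContinuousOn f (sphere 0 ρ) := hf.continuousOn.mono (sphere_subset_unitDisc hρ1)
  have hfi : CircleIntegrable (fun u => ‖f u‖ ^ 2) 0 ρ :=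
    (hfc.norm.pow 2).circleIntegrable hρ.le
  have hfi' : CircleIntegrable (fun u => ((‖f u‖ ^ 2 : ℝ) : ℂ)) 0 ρ :=
    ContinuousOn.circleIntegrable hρ.le
      (Complex.continuous_ofReal.comp_continuousOn (hfc.norm.pow 2))
  -- `G` is holomorphic with real part the Poisson integral of `|f|²`. Thus `Re (G ∘ φ)` majorizes
  -- `|f ∘ φ|²` and has the mean value property.
  set G : ℂ → ℂ := fun w =>
    circleAverage (fun ζ => herglotzRieszKernel 0 w ζ • ((‖f ζ‖ ^ 2 : ℝ) : ℂ)) 0 ρ with hG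
  have hGd : DifferentiableOn ℂ G (ball 0 ρ) :=
    differentiableOn_circleAverage_herglotzRieszKernel_smul hfi'
  have hGre : ∀ w ∈ ball (0 : ℂ) ρ,
      (G w).re = circleAverage (fun u => poissonKernel 0 w u * ‖f u‖ ^ 2) 0 ρ := fun w hw => by
    rw [hG, re_circleAverage_herglotzRieszKernel_smul hfi hw,
      poissonKernel_eq_re_herglotzRieszKernel]
    rfl
  have hφr : DifferentiableOn ℂ φ (closedBall 0 r) := hφ.mono (closedBall_subset_ball hr1)
  have hGφ : DifferentiableOn ℂ (fun u => G (φ u)) (closedBall 0 r) := hGd.comp hφr hmap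
  have hsc : sphere (0 : ℂ) r ⊆ closedBall 0 r := sphere_subset_closedBall
  have hmap' : ∀ u ∈ closedBall (0 : ℂ) r, φ u ∈ unitDisc :=
    fun u hu => ball_subset_ball hρ1.le (hmap u hu)
  have hmean : circleAverage (fun u => (G (φ u)).re) 0 r = (G (φ 0)).re := by
    have h := Complex.reCLM.circleAverage_comp_comm (f := fun u => G (φ u))
      ((hGφ.continuousOn.mono hsc).circleIntegrable hr)
    rw [DiffContOnCl.circleAverage] at h
    · exact h
    · rw [abs_of_nonneg hr]
      exact DifferentiableOn.diffContOnCl (hGφ.mono closure_ball_subset_closedBall)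
  calc circleAverage (fun u => ‖f (φ u)‖ ^ 2) 0 r
      ≤ circleAverage (fun u => (G (φ u)).re) 0 r := by
        refine circleAverage_mono ?_ ?_ fun u hu => ?_
        · exact ContinuousOn.circleIntegrable hr
            (((hf.continuousOn.comp hφr.continuousOn hmap').mono hsc).norm.pow 2)
        · exact ContinuousOn.circleIntegrable hr
            (Complex.continuous_re.comp_continuousOn (hGφ.continuousOn.mono hsc))
        · rw [abs_of_nonneg hr] at hu
          have hu' := hmap u (hsc hu)
          rw [hGre _ hu']
          exact sq_norm_le_poisson hf hρ hρ1 hu'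
    _ = circleAverage (fun u => poissonKernel 0 (φ 0) u * ‖f u‖ ^ 2) 0 ρ := by
        rw [hmean, hGre _ h0]
    -- Harnack's bound for the Poisson kernel at `φ 0`.
    _ ≤ circleAverage (fun u => ((ρ + ‖φ 0‖) / (ρ - ‖φ 0‖)) • ‖f u‖ ^ 2) 0 ρ := by
        refine circleAverage_mono ?_ ?_ fun u hu => ?_
        · exact ContinuousOn.circleIntegrable hρ.le
            ((continuousOn_poissonKernel_sphere hρ.le h0).mul (hfc.norm.pow 2))
        · exact ContinuousOn.circleIntegrable hρ.le (continuousOn_const.mul (hfc.norm.pow 2))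
        · rw [abs_of_pos hρ] at hu
          rw [smul_eq_mul]
          refine mul_le_mul_of_nonneg_right ?_ (sq_nonneg _)
          rw [poissonKernel_eq_re_herglotzRieszKernel]
          simpa [herglotzRieszKernel_def] using re_herglotzRieszKernel_le hu h0
    _ = _ := by rw [circleAverage_fun_smul, smul_eq_mul]

end RationalComposition

namespace RationalComposition

open Real Metric Filter Topology

/-! ### From bounds on circle means to the operator on `H²`. -/

namespace H2

@[ext] theorem ext {f g : H2} (h : ∀ z ∈ unitDisc, f z = g z) : f = g := by
  refine Subtype.ext (funext fun z => ?_)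
  by_cases hz : z ∈ unitDisc
  · exact h z hz
  · exact (f.isHardy.2.1 z hz).trans (g.isHardy.2.1 z hz).symm

/-- The element of `H²` given by a function. -/
def mk (f : ℂ → ℂ) (hf : IsHardy f) : H2 := (⟨f, hf⟩ : hardySubmodule)

theorem mk_apply (f : ℂ → ℂ) (hf : IsHardy f) (z : ℂ) : mk f hf z = f z := rfl

theorem coeff_add (f g : H2) (n : ℕ) :
    maclaurinCoeff (f + g : H2) n = maclaurinCoeff f n + maclaurinCoeff g n :=
  maclaurinCoeff_add f.isHardy.1 g.isHardy.1 n

theorem coeff_smul (c : ℂ) (f : H2) (n : ℕ) :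
    maclaurinCoeff (c • f : H2) n = c * maclaurinCoeff f n :=
  maclaurinCoeff_smul c f n

theorem sum_apply {ι : Type*} (s : Finset ι) (f : ι → H2) (z : ℂ) :
    (∑ i ∈ s, f i) z = ∑ i ∈ s, f i z :=
  map_sum (AddMonoidHom.mk' (fun g : H2 => g z) fun g h => add_apply g h z) f s

theorem summable_sq (f : H2) : Summable fun n => ‖maclaurinCoeff f n‖ ^ 2 := f.isHardy.2.2

theorem circleAverage_sq_le (f : H2) {ρ : ℝ} (hρ : 0 ≤ ρ) (hρ1 : ρ < 1) :
    circleAverage (fun u => ‖f u‖ ^ 2) 0 ρ ≤ ‖f‖ ^ 2 := by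
  rw [norm_sq_eq_tsum]
  refine hasSum_le (fun n => ?_) (hasSum_sq_maclaurinCoeff f.isHardy.1 hρ hρ1)
    f.summable_sq.hasSum
  exact mul_le_of_le_one_right (sq_nonneg _) (pow_le_one₀ hρ hρ1.le)

end H2

/-- In a finite partial sum of Parseval's series the weights `r ^ (2n)` tend to `1` as `r → 1`. -/
theorem sum_sq_maclaurinCoeff_le {F : ℂ → ℂ} (hF : DifferentiableOn ℂ F unitDisc) {M : ℝ}
    (h : ∀ r, 0 ≤ r → r < 1 → circleAverage (fun u => ‖F u‖ ^ 2) 0 r ≤ M) (N : ℕ) :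
    ∑ n ∈ Finset.range N, ‖maclaurinCoeff F n‖ ^ 2 ≤ M := by
  have ht : Tendsto (fun r : ℝ => ∑ n ∈ Finset.range N, ‖maclaurinCoeff F n‖ ^ 2 * r ^ (2 * n))
      (𝓝[<] 1) (𝓝 (∑ n ∈ Finset.range N, ‖maclaurinCoeff F n‖ ^ 2)) := by
    have hc : Continuous fun r : ℝ =>
        ∑ n ∈ Finset.range N, ‖maclaurinCoeff F n‖ ^ 2 * r ^ (2 * n) := by fun_prop
    simpa using (hc.tendsto 1).mono_left nhdsWithin_le_nhds
  refine le_of_tendsto ht ?_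
  filter_upwards [Ioo_mem_nhdsLT (zero_lt_one' ℝ)] with r hr
  refine le_trans ?_ (h r hr.1.le hr.2)
  exact sum_le_hasSum _ (fun n _ => by have := hr.1; positivity)
    (hasSum_sq_maclaurinCoeff hF hr.1.le hr.2)

/-- Compactness gives a strictly smaller disc. The lower bound `b` is there to keep `ρ` away from
`‖φ 0‖`, so that the Harnack constant stays bounded. -/
theorem exists_radius_mapsTo {φ : ℂ → ℂ} (hφ : DifferentiableOn ℂ φ unitDisc)
    (hm : Set.MapsTo φ unitDisc unitDisc) {r : ℝ} (hr : 0 ≤ r) (hr1 : r < 1) (b : ℝ) (hb : b < 1) :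
    ∃ ρ, b ≤ ρ ∧ ρ < 1 ∧ ∀ u ∈ closedBall (0 : ℂ) r, φ u ∈ ball 0 ρ := by
  have hsub : closedBall (0 : ℂ) r ⊆ unitDisc := closedBall_subset_ball hr1
  obtain ⟨x, hx, hmax⟩ := (isCompact_closedBall (0 : ℂ) r).exists_isMaxOn
    (nonempty_closedBall.2 hr) ((hφ.continuousOn.mono hsub).norm)
  have hx1 : ‖φ x‖ < 1 := mem_unitDisc.1 (hm (hsub hx))
  obtain ⟨ρ, h1, h2⟩ := exists_between (max_lt hx1 hb)
  refine ⟨ρ, (le_max_right _ _).trans h1.le, h2, fun u hu => ?_⟩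
  rw [mem_ball_zero_iff]
  exact lt_of_le_of_lt (hmax hu) (lt_of_le_of_lt (le_max_left _ _) h1)

theorem differentiableOn_indicator_comp {φ : ℂ → ℂ} (hφ : DifferentiableOn ℂ φ unitDisc)
    (hm : Set.MapsTo φ unitDisc unitDisc) (f : H2) :
    DifferentiableOn ℂ (unitDisc.indicator fun z => f (φ z)) unitDisc :=
  (f.isHardy.1.comp hφ hm).congr fun _ hz => Set.indicator_of_mem hz _

theorem circleAverage_sq_indicator_comp_le {φ : ℂ → ℂ} (hφ : DifferentiableOn ℂ φ unitDisc)
    (hm : Set.MapsTo φ unitDisc unitDisc) (f : H2) {r : ℝ} (hr : 0 ≤ r) (hr1 : r < 1) :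
    circleAverage (fun u => ‖unitDisc.indicator (fun z => f (φ z)) u‖ ^ 2) 0 r
      ≤ 4 / (1 - ‖φ 0‖) * ‖f‖ ^ 2 := by
  have ha : ‖φ 0‖ < 1 := mem_unitDisc.1 (hm zero_mem_unitDisc)
  have ha0 := norm_nonneg (φ 0)
  -- With this `b`, `ρ - ‖φ 0‖ ≥ (1 - ‖φ 0‖) / 2` and `ρ + ‖φ 0‖ ≤ 2`, hence the constant `4 / (1 -
  -- ‖φ 0‖)`, independent of `r`.
  obtain ⟨ρ, h1, h2, h3⟩ := exists_radius_mapsTo hφ hm hr hr1 ((1 + ‖φ 0‖) / 2) (by linarith)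
  have hcongr : Set.EqOn (fun u => ‖unitDisc.indicator (fun z => f (φ z)) u‖ ^ 2)
      (fun u => ‖f (φ u)‖ ^ 2) (sphere 0 |r|) := by
    intro u hu
    rw [abs_of_nonneg hr] at hu
    simp only [Set.indicator_of_mem (sphere_subset_unitDisc hr1 hu)]
  rw [circleAverage_congr_sphere hcongr]
  refine (circleAverage_sq_comp_le f.isHardy.1 hφ hr hr1 h2 h3).trans ?_
  refine mul_le_mul ?_ (f.circleAverage_sq_le (by linarith) h2)
    (circleAverage_nonneg_of_nonneg fun _ _ => sq_nonneg _)
    (div_nonneg (by norm_num) (by linarith))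
  rw [div_le_div_iff₀ (by linarith) (by linarith)]
  nlinarith

theorem isHardy_indicator_comp {φ : ℂ → ℂ} (hφ : DifferentiableOn ℂ φ unitDisc)
    (hm : Set.MapsTo φ unitDisc unitDisc) (f : H2) : IsHardy (unitDisc.indicator fun z => f (φ z)) :=
  ⟨differentiableOn_indicator_comp hφ hm f, fun _ hz => Set.indicator_of_notMem hz _,
    summable_of_sum_range_le (fun _ => sq_nonneg _)
      (sum_sq_maclaurinCoeff_le (differentiableOn_indicator_comp hφ hm f)
        fun _ hr hr1 => circleAverage_sq_indicator_comp_le hφ hm f hr hr1)⟩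

/-- The composition operator of a holomorphic self-map of the disc. -/
noncomputable def compositionOperator {φ : ℂ → ℂ} (hφ : DifferentiableOn ℂ φ unitDisc)
    (hm : Set.MapsTo φ unitDisc unitDisc) : H2 →L[ℂ] H2 :=
  LinearMap.mkContinuous
    { toFun := fun f => H2.mk _ (isHardy_indicator_comp hφ hm f)
      map_add' := fun f g => by
        refine H2.ext fun z hz => ?_
        simp only [H2.add_apply, H2.mk_apply, Set.indicator_of_mem hz]
      map_smul' := fun c f => by
        refine H2.ext fun z hz => ?_
        simp only [RingHom.id_apply, H2.smul_apply, H2.mk_apply, Set.indicator_of_mem hz] }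
    (√(4 / (1 - ‖φ 0‖)))
    (fun f => by
      have ha : ‖φ 0‖ < 1 := mem_unitDisc.1 (hm zero_mem_unitDisc)
      have h0 : 0 ≤ 4 / (1 - ‖φ 0‖) := div_nonneg (by norm_num) (by linarith)
      refine le_of_sq_le_sq ?_ (by positivity)
      rw [mul_pow, Real.sq_sqrt h0, H2.norm_sq_eq_tsum]
      exact Real.tsum_le_of_sum_range_le (fun _ => sq_nonneg _)
        (sum_sq_maclaurinCoeff_le (differentiableOn_indicator_comp hφ hm f)
          fun _ hr hr1 => circleAverage_sq_indicator_comp_le hφ hm f hr hr1))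

theorem compositionOperator_apply {φ : ℂ → ℂ} (hφ : DifferentiableOn ℂ φ unitDisc)
    (hm : Set.MapsTo φ unitDisc unitDisc) (f : H2) {z : ℂ} (hz : z ∈ unitDisc) :
    compositionOperator hφ hm f z = f (φ z) :=
  (H2.mk_apply _ (isHardy_indicator_comp hφ hm f) z).trans (Set.indicator_of_mem hz _)

/-! ### The backward shift and its kernel functions -/

namespace H2

/-- The element of `H²` with given square-summable Maclaurin coefficients. -/
noncomputable def ofCoeffs (a : ℕ → ℂ) (ha : Summable fun n => ‖a n‖ ^ 2) : H2 :=
  coeffsEquiv.symm ⟨a, memℓp_two_iff.2 ha⟩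

theorem maclaurinCoeff_ofCoeffs (a : ℕ → ℂ) (ha : Summable fun n => ‖a n‖ ^ 2) (n : ℕ) :
    maclaurinCoeff (ofCoeffs a ha) n = a n := by
  rw [← coeffs_apply]
  have h : coeffs (ofCoeffs a ha) = ⟨a, memℓp_two_iff.2 ha⟩ := coeffsEquiv.apply_symm_apply _
  rw [h]

theorem ext_coeff {f g : H2} (h : ∀ n, maclaurinCoeff f n = maclaurinCoeff g n) : f = g :=
  coeffs_injective (by ext n; exact h n)

theorem hasSum_apply (f : H2) {z : ℂ} (hz : z ∈ unitDisc) :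
    HasSum (fun n => maclaurinCoeff f n * z ^ n) (f z) :=
  hasSum_maclaurinCoeff f.isHardy.1 hz

theorem maclaurinCoeff_zero (f : H2) : maclaurinCoeff f 0 = f 0 := by
  simp [maclaurinCoeff]

theorem summable_sq_succ (f : H2) : Summable fun n => ‖maclaurinCoeff f (n + 1)‖ ^ 2 :=
  (summable_nat_add_iff (f := fun n => ‖maclaurinCoeff f n‖ ^ 2) 1).2 f.summable_sq

/-- The backward shift as an operator on `H²`. -/
noncomputable def shift : H2 →L[ℂ] H2 :=
  LinearMap.mkContinuous
    { toFun := fun f => ofCoeffs _ f.summable_sq_succ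
      map_add' := fun f g => ext_coeff fun n => by
        simp only [coeff_add, maclaurinCoeff_ofCoeffs]
      map_smul' := fun c f => ext_coeff fun n => by
        simp only [RingHom.id_apply, coeff_smul, maclaurinCoeff_ofCoeffs] }
    1
    (fun f => by
      rw [one_mul]
      refine le_of_sq_le_sq ?_ (norm_nonneg _)
      rw [norm_sq_eq_tsum, norm_sq_eq_tsum, f.summable_sq.tsum_eq_zero_add]
      simp only [LinearMap.coe_mk, AddHom.coe_mk, maclaurinCoeff_ofCoeffs]
      exact le_add_of_nonneg_left (sq_nonneg _))

theorem maclaurinCoeff_shift (f : H2) (n : ℕ) :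
    maclaurinCoeff (shift f) n = maclaurinCoeff f (n + 1) :=
  maclaurinCoeff_ofCoeffs _ f.summable_sq_succ n

theorem apply_eq_add_shift (f : H2) {z : ℂ} (hz : z ∈ unitDisc) :
    f z = f 0 + z * shift f z := by
  have h1 := (f.hasSum_apply hz).summable.tsum_eq_zero_add
  rw [(f.hasSum_apply hz).tsum_eq] at h1
  have h2 := ((shift f).hasSum_apply hz).mul_left z
  rw [h1, ← h2.tsum_eq, ← maclaurinCoeff_zero, pow_zero, mul_one]
  congr 1
  refine tsum_congr fun n => ?_
  rw [maclaurinCoeff_shift]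
  ring

theorem shift_apply (f : H2) {z : ℂ} (hz : z ∈ unitDisc) : shift f z = backwardShift f z := by
  by_cases h : z = 0
  · subst h
    rw [backwardShift, if_pos rfl, ← maclaurinCoeff_zero, maclaurinCoeff_shift]
    simp [maclaurinCoeff]
  · rw [backwardShift, if_neg h, f.apply_eq_add_shift hz]
    field_simp
    ring

theorem summable_sq_pow {z : ℂ} (hz : z ∈ unitDisc) :
    Summable fun n : ℕ => ‖z ^ n‖ ^ 2 := by
  have h : ‖z‖ ^ 2 < 1 := by
    have := mem_unitDisc.1 hz
    nlinarith [norm_nonneg z]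
  simpa only [norm_pow, ← pow_mul, mul_comm _ 2] using
    summable_geometric_of_lt_one (sq_nonneg ‖z‖) h

theorem conj_mem_unitDisc {z : ℂ} (hz : z ∈ unitDisc) : starRingEnd ℂ z ∈ unitDisc := by
  rw [mem_unitDisc] at *
  simpa using hz

/-- The sequence is `0, 1, conj z, (conj z)², …`: the offset by one pairs the power `n` with the
coefficient of index `n + 1`, which is what the backward shift requires. -/
theorem summable_sq_shiftKernel {z : ℂ} (hz : z ∈ unitDisc) :
    Summable fun n : ℕ => ‖Nat.casesOn (motive := fun _ => ℂ) n 0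
      fun k => starRingEnd ℂ z ^ k‖ ^ 2 :=
  (summable_nat_add_iff 1).1 (summable_sq_pow (conj_mem_unitDisc hz))

/-- The function `u ↦ u / (1 - conj z * u)`, which represents the evaluation at `z` of the
backward shift. -/
noncomputable def shiftKernel {z : ℂ} (hz : z ∈ unitDisc) : H2 :=
  ofCoeffs _ (summable_sq_shiftKernel hz)

theorem maclaurinCoeff_shiftKernel_zero {z : ℂ} (hz : z ∈ unitDisc) :
    maclaurinCoeff (shiftKernel hz) 0 = 0 :=
  maclaurinCoeff_ofCoeffs _ (summable_sq_shiftKernel hz) 0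

theorem maclaurinCoeff_shiftKernel_succ {z : ℂ} (hz : z ∈ unitDisc) (n : ℕ) :
    maclaurinCoeff (shiftKernel hz) (n + 1) = starRingEnd ℂ z ^ n :=
  maclaurinCoeff_ofCoeffs _ (summable_sq_shiftKernel hz) (n + 1)

theorem one_sub_conj_mul_ne_zero {z u : ℂ} (hz : z ∈ unitDisc) (hu : u ∈ unitDisc) :
    1 - starRingEnd ℂ z * u ≠ 0 := by
  rw [mem_unitDisc] at hz hu
  intro h
  have h1 : ‖starRingEnd ℂ z * u‖ = 1 := by rw [← sub_eq_zero.1 h, norm_one]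
  rw [norm_mul, RCLike.norm_conj] at h1
  nlinarith [norm_nonneg z, norm_nonneg u]

theorem shiftKernel_apply {z u : ℂ} (hz : z ∈ unitDisc) (hu : u ∈ unitDisc) :
    shiftKernel hz u = u / (1 - starRingEnd ℂ z * u) := by
  have h := (shiftKernel hz).hasSum_apply hu
  have h1 := h.summable.tsum_eq_zero_add
  rw [h.tsum_eq] at h1
  rw [h1]
  simp only [maclaurinCoeff_shiftKernel_zero, maclaurinCoeff_shiftKernel_succ]
  rw [zero_mul, zero_add]
  have h2 : ‖starRingEnd ℂ z * u‖ < 1 := by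
    rw [mem_unitDisc] at hz hu
    rw [norm_mul, RCLike.norm_conj]
    nlinarith [norm_nonneg z, norm_nonneg u]
  rw [div_eq_mul_inv, ← ((hasSum_geometric_of_norm_lt_one h2).mul_left u).tsum_eq]
  refine tsum_congr fun n => ?_
  ring

theorem inner_shiftKernel {z : ℂ} (hz : z ∈ unitDisc) (f : H2) :
    inner ℂ (shiftKernel hz) f = shift f z := by
  have hs : Summable fun n => starRingEnd ℂ (maclaurinCoeff (shiftKernel hz) n) *
      maclaurinCoeff f n := by
    refine (summable_nat_add_iff 1).1 ?_
    simpa only [maclaurinCoeff_shiftKernel_succ, map_pow, Complex.conj_conj,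
      maclaurinCoeff_shift, mul_comm] using ((shift f).hasSum_apply hz).summable
  rw [inner_eq_tsum, hs.tsum_eq_zero_add, ← ((shift f).hasSum_apply hz).tsum_eq]
  simp only [maclaurinCoeff_shiftKernel_zero, maclaurinCoeff_shiftKernel_succ, map_zero, zero_mul, zero_add, map_pow,
    Complex.conj_conj, maclaurinCoeff_shift, mul_comm]

theorem summable_sq_single : Summable fun n : ℕ => ‖(if n = 0 then 1 else 0 : ℂ)‖ ^ 2 :=
  summable_of_ne_finset_zero (s := {0}) fun n hn => by
    simp [Finset.notMem_singleton.1 hn]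

/-- The constant function `1` on the disc. -/
noncomputable def one : H2 := ofCoeffs _ summable_sq_single

theorem one_apply {z : ℂ} (hz : z ∈ unitDisc) : one z = 1 := by
  refine (one.hasSum_apply hz).unique ?_
  simp only [one, maclaurinCoeff_ofCoeffs]
  convert hasSum_ite_eq 0 (1 : ℂ) using 2 with n
  by_cases hn : n = 0 <;> simp [hn]

theorem inner_one (f : H2) : inner ℂ one f = f 0 := by
  rw [inner_eq_tsum, tsum_eq_single 0]
  · rw [maclaurinCoeff_zero f, one, maclaurinCoeff_ofCoeffs, if_pos rfl, map_one, one_mul]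
  · intro n hn
    simp [one, maclaurinCoeff_ofCoeffs, hn]

end H2

end RationalComposition

namespace RationalComposition

open Polynomial

/-! ### Reflection of polynomials in the unit circle -/

/-- The polynomial `u ^ d * conj (A (1 / conj u))`, for `A` of degree at most `d`. -/
noncomputable def conjReflect (d : ℕ) (A : ℂ[X]) : ℂ[X] :=
  (A.map (starRingEnd ℂ)).reflect d

theorem coeff_conjReflect {d i : ℕ} (h : i ≤ d) (A : ℂ[X]) :
    (conjReflect d A).coeff i = starRingEnd ℂ (A.coeff (d - i)) := by
  rw [conjReflect, coeff_reflect, revAt_le h, coeff_map]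

theorem natDegree_conjReflect_le {d : ℕ} {A : ℂ[X]} (hA : A.natDegree ≤ d) :
    (conjReflect d A).natDegree ≤ d := by
  refine (natDegree_reflect_le ..).trans ?_
  rw [natDegree_map]
  exact max_le le_rfl hA

theorem eval_conjReflect {d : ℕ} {A : ℂ[X]} (hA : A.natDegree ≤ d) {u : ℂ} (hu : u ≠ 0) :
    (conjReflect d A).eval u = u ^ d * starRingEnd ℂ (A.eval (1 / starRingEnd ℂ u)) := by
  let _ : Invertible u⁻¹ := invertibleOfNonzero (inv_ne_zero hu)
  have h := eval₂_reflect_mul_pow (RingHom.id ℂ) u⁻¹ d (A.map (starRingEnd ℂ))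
    (by rwa [natDegree_map])
  rw [invOf_eq_inv, inv_inv, eval₂_id, eval₂_id, eval_map, inv_pow] at h
  have h1 : starRingEnd ℂ (A.eval (1 / starRingEnd ℂ u)) = A.eval₂ (starRingEnd ℂ) u⁻¹ := by
    rw [eval, hom_eval₂]
    simp
  rw [h1, ← h, conjReflect]
  field_simp

theorem eval_zero_conjReflect (d : ℕ) (A : ℂ[X]) :
    (conjReflect d A).eval 0 = starRingEnd ℂ (A.coeff d) := by
  rw [← coeff_zero_eq_eval_zero, coeff_conjReflect (Nat.zero_le d), Nat.sub_zero]

/-! ### Rational maps of the sphere -/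

/-- Coprimality matters at poles: where `q` vanishes `p` does not, so no spurious root appears. -/
theorem sphereMap_coe_eq_coe_iff {p q : ℂ[X]} (hpq : IsCoprime p q) (u w : ℂ) :
    sphereMap p q (u : OnePoint ℂ) = (w : OnePoint ℂ) ↔ (p - C w * q).eval u = 0 := by
  have h : sphereMap p q (u : OnePoint ℂ) =
    if q.eval u = 0 then OnePoint.infty else ((p.eval u / q.eval u : ℂ) : OnePoint ℂ) := rfl
  rw [h, eval_sub, eval_mul, eval_C]
  split_ifs with hq
  · refine iff_of_false (OnePoint.infty_ne_coe w) fun h0 => ?_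
    rw [hq, mul_zero, sub_zero] at h0
    obtain ⟨a, b, hab⟩ := hpq
    have := congrArg (eval u) hab
    simp [hq, h0] at this
  · rw [OnePoint.coe_eq_coe, div_eq_iff hq, sub_eq_zero]

/-- A nonzero top coefficient of `p - w q` keeps `∞` out of the fibre over `w`, so the whole fibre
consists of roots in the plane. -/
theorem sphereMap_infty_ne_coe {p q : ℂ[X]} {w : ℂ}
    (h : (p - C w * q).coeff (max p.natDegree q.natDegree) ≠ 0) :
    sphereMap p q OnePoint.infty ≠ (w : OnePoint ℂ) := by
  have h1 : sphereMap p q OnePoint.infty =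
      if q.coeff (max p.natDegree q.natDegree) = 0 then OnePoint.infty
      else ((p.coeff (max p.natDegree q.natDegree) /
        q.coeff (max p.natDegree q.natDegree) : ℂ) : OnePoint ℂ) := rfl
  rw [h1]
  split_ifs with hq
  · exact OnePoint.infty_ne_coe w
  · rw [Ne, OnePoint.coe_eq_coe, div_eq_iff hq]
    intro h2
    simp [h2] at h

theorem preimage_sphereMap_coe {p q : ℂ[X]} (hpq : IsCoprime p q) {w : ℂ}
    (h : (p - C w * q).coeff (max p.natDegree q.natDegree) ≠ 0) :
    sphereMap p q ⁻¹' {(w : OnePoint ℂ)} =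
      (fun u : ℂ => (u : OnePoint ℂ)) '' {u | (p - C w * q).eval u = 0} := by
  ext x
  induction x using OnePoint.rec with
  | infty => simpa using sphereMap_infty_ne_coe h
  | coe u => simp [sphereMap_coe_eq_coe_iff hpq]

/-- The degree of a rational map of the sphere is well defined. -/
theorem IsRationalOfDegree.unique {R : OnePoint ℂ → OnePoint ℂ} {d d' : ℕ}
    (h : IsRationalOfDegree R d) (h' : IsRationalOfDegree R d') : d = d' := by
  obtain ⟨p, q, hpq, rfl, rfl⟩ := h
  obtain ⟨p', q', hpq', he, rfl⟩ := h'
  -- Equal maps have equal cross products at every finite point, poles included. Coprimality then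
  -- makes the numerators, and the denominators, associated.
  have hmul : p * q' = p' * q := by
    refine Polynomial.funext fun u => ?_
    have hu := congrFun he (u : OnePoint ℂ)
    have h1 : ∀ a b : ℂ[X], sphereMap a b (u : OnePoint ℂ) = if b.eval u = 0 then OnePoint.infty
      else ((a.eval u / b.eval u : ℂ) : OnePoint ℂ) := fun _ _ => rfl
    rw [h1, h1] at hu
    rw [eval_mul, eval_mul]
    by_cases hq : q.eval u = 0
    · by_cases hq' : q'.eval u = 0
      · rw [hq, hq', mul_zero, mul_zero]
      · rw [if_pos hq, if_neg hq'] at hu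
        exact absurd hu (OnePoint.infty_ne_coe _)
    · by_cases hq' : q'.eval u = 0
      · rw [if_neg hq, if_pos hq'] at hu
        exact absurd hu (OnePoint.coe_ne_infty _)
      · rw [if_neg hq, if_neg hq', OnePoint.coe_eq_coe, div_eq_div_iff hq hq'] at hu
        exact hu
  have hp : Associated p p' := associated_of_dvd_dvd
    (hpq.dvd_of_dvd_mul_right (Dvd.intro _ hmul))
    (hpq'.dvd_of_dvd_mul_right (Dvd.intro _ hmul.symm))
  have hq : Associated q q' := associated_of_dvd_dvd
    (hpq.symm.dvd_of_dvd_mul_left (Dvd.intro_left _ hmul.symm))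
    (hpq'.symm.dvd_of_dvd_mul_left (Dvd.intro_left _ hmul))
  rw [natDegree_eq_natDegree (degree_eq_degree_of_associated hp),
    natDegree_eq_natDegree (degree_eq_degree_of_associated hq)]

/-! ### Partial fractions -/

/-- The coefficients of degree `d` cancel in the difference, which then has degree below `d` and `d`
distinct zeros. -/
theorem eq_C_mul_nodal {d : ℕ} {M : ℂ[X]} (hM : M.natDegree ≤ d) {v : Fin d → ℂ}
    (hv : Function.Injective v) (hroot : ∀ j, M.eval (v j) = 0) :
    M = C (M.coeff d) * Lagrange.nodal Finset.univ v := by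
  refine sub_eq_zero.1 (Polynomial.eq_zero_of_degree_lt_of_eval_index_eq_zero Finset.univ
    hv.injOn ?_ fun j hj => ?_)
  · have hn : (Lagrange.nodal Finset.univ v).natDegree = d := by
      rw [Lagrange.natDegree_nodal, Finset.card_univ, Fintype.card_fin]
    have hc : (Lagrange.nodal Finset.univ v).coeff d = 1 := by
      have := (Lagrange.nodal_monic (s := Finset.univ) (v := v)).coeff_natDegree
      rwa [hn] at this
    rw [Finset.card_univ, Fintype.card_fin, degree_lt_iff_coeff_zero]
    intro m hm
    rcases hm.eq_or_lt with rfl | hlt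
    · simp [hc]
    · rw [coeff_sub, coeff_C_mul, coeff_eq_zero_of_natDegree_lt (hM.trans_lt hlt),
        coeff_eq_zero_of_natDegree_lt (hn.trans_lt hlt), mul_zero, sub_zero]
  · rw [eval_sub, eval_mul, hroot, Lagrange.eval_nodal_at_node hj, mul_zero, sub_zero]

theorem eval_derivative_eq {d : ℕ} {M : ℂ[X]} (hM : M.natDegree ≤ d) {v : Fin d → ℂ}
    (hv : Function.Injective v) (hroot : ∀ j, M.eval (v j) = 0) (j : Fin d) :
    M.derivative.eval (v j) = M.coeff d * (Lagrange.nodalWeight Finset.univ v j)⁻¹ := by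
  rw [Lagrange.nodalWeight_eq_eval_derivative_nodal (Finset.mem_univ j), inv_inv]
  conv_lhs => rw [eq_C_mul_nodal hM hv hroot]
  rw [derivative_C_mul, eval_mul, eval_C]

theorem eval_derivative_ne_zero {d : ℕ} {M : ℂ[X]} (hM : M.natDegree ≤ d)
    (hM0 : M.coeff d ≠ 0) {v : Fin d → ℂ}
    (hv : Function.Injective v) (hroot : ∀ j, M.eval (v j) = 0) (j : Fin d) :
    M.derivative.eval (v j) ≠ 0 := by
  rw [eval_derivative_eq hM hv hroot]
  exact mul_ne_zero hM0
    (inv_ne_zero (Lagrange.nodalWeight_ne_zero hv.injOn (Finset.mem_univ j)))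

/-- Partial fraction decomposition for a denominator with simple roots. -/
theorem eval_div_eval_eq {d : ℕ} {M Q : ℂ[X]} (hM : M.natDegree ≤ d) (hM0 : M.coeff d ≠ 0)
    (hQ : Q.natDegree ≤ d) {v : Fin d → ℂ} (hv : Function.Injective v)
    (hroot : ∀ j, M.eval (v j) = 0) {x : ℂ} (hx : ∀ j, x ≠ v j) :
    Q.eval x / M.eval x = Q.coeff d / M.coeff d +
      ∑ j, Q.eval (v j) / M.derivative.eval (v j) * (x - v j)⁻¹ := by
  set c := Q.coeff d / M.coeff d with hc
  -- Subtracting the value `c` of `Q / M` at `∞` brings the degree below `d` without changing values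
  -- at the nodes. The barycentric form of the interpolant, divided by `M`, is the partial fraction
  -- sum.
  have hT : Q - C c * M = Lagrange.interpolate Finset.univ v fun j => Q.eval (v j) := by
    refine Lagrange.eq_interpolate_of_eval_eq _ hv.injOn ?_ fun j _ => ?_
    · rw [Finset.card_univ, Fintype.card_fin, degree_lt_iff_coeff_zero]
      intro m hm
      rw [coeff_sub, coeff_C_mul]
      rcases hm.eq_or_lt with rfl | hlt
      · rw [hc, div_mul_cancel₀ _ hM0, sub_self]
      · rw [coeff_eq_zero_of_natDegree_lt (hM.trans_lt hlt),
          coeff_eq_zero_of_natDegree_lt (hQ.trans_lt hlt), mul_zero, sub_zero]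
    · rw [eval_sub, eval_mul, hroot, mul_zero, sub_zero]
  have hn0 : (Lagrange.nodal Finset.univ v).eval x ≠ 0 :=
    Lagrange.eval_nodal_not_at_node fun j _ => hx j
  have hMx : M.eval x = M.coeff d * (Lagrange.nodal Finset.univ v).eval x := by
    conv_lhs => rw [eq_C_mul_nodal hM hv hroot]
    rw [eval_mul, eval_C]
  have hTx := congrArg (eval x) hT
  rw [Lagrange.eval_interpolate_not_at_node _ fun j _ => hx j, eval_sub, eval_mul, eval_C,
    sub_eq_iff_eq_add] at hTx
  have hMx0 : M.eval x ≠ 0 := hMx ▸ mul_ne_zero hM0 hn0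
  rw [hTx, add_div, mul_div_cancel_right₀ _ hMx0, add_comm, hMx, mul_comm (M.coeff d),
    mul_div_mul_left _ _ hn0, Finset.sum_div]
  congr 1
  refine Finset.sum_congr rfl fun j _ => ?_
  rw [eval_derivative_eq hM hv hroot]
  have hw := Lagrange.nodalWeight_ne_zero hv.injOn (Finset.mem_univ j)
  field_simp

theorem exists_enumeration_of_encard_roots {d : ℕ} {M : ℂ[X]}
    (h : {u | M.eval u = 0}.encard = d) :
    ∃ v : Fin d → ℂ, Function.Injective v ∧ ∀ u, M.eval u = 0 ↔ ∃ j, v j = u := by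
  have hfin : {u | M.eval u = 0}.Finite :=
    Set.finite_of_encard_eq_coe h
  have hcard : hfin.toFinset.card = d := by
    rw [hfin.encard_eq_coe_toFinset_card] at h
    exact_mod_cast h
  refine ⟨fun j => (hfin.toFinset.equivFinOfCardEq hcard).symm j,
    fun i j hij => (hfin.toFinset.equivFinOfCardEq hcard).symm.injective (Subtype.ext hij),
    fun u => ⟨fun hu => ?_, ?_⟩⟩
  · exact ⟨hfin.toFinset.equivFinOfCardEq hcard ⟨u, hfin.mem_toFinset.2 hu⟩, by simp⟩
  · rintro ⟨j, rfl⟩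
    exact hfin.mem_toFinset.1 ((hfin.toFinset.equivFinOfCardEq hcard).symm j).2

end RationalComposition

namespace RationalComposition

open Polynomial Filter Topology

/-! ### The exterior map -/

/-- The degree of a rational function. -/
noncomputable def ratDegree (φ : RatFunc ℂ) : ℕ := max φ.num.natDegree φ.denom.natDegree

/-- The numerator of the exterior map. -/
noncomputable def extNum (φ : RatFunc ℂ) : ℂ[X] := conjReflect (ratDegree φ) φ.denom

/-- The denominator of the exterior map. -/
noncomputable def extDenom (φ : RatFunc ℂ) : ℂ[X] := conjReflect (ratDegree φ) φ.num

/-- The polynomial whose roots are the preimages of `w` under the exterior map. -/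
noncomputable def fiberPoly (φ : RatFunc ℂ) (w : ℂ) : ℂ[X] := extNum φ - C w * extDenom φ

theorem natDegree_num_le (φ : RatFunc ℂ) : φ.num.natDegree ≤ ratDegree φ := le_max_left _ _

theorem natDegree_denom_le (φ : RatFunc ℂ) : φ.denom.natDegree ≤ ratDegree φ := le_max_right _ _

theorem evalAt_eq (φ : RatFunc ℂ) (z : ℂ) : evalAt φ z = φ.num.eval z / φ.denom.eval z := by
  rw [evalAt, RatFunc.eval, eval₂_id, eval₂_id]

theorem eval_num_denom_ne_zero (φ : RatFunc ℂ) {u : ℂ} (h : φ.denom.eval u = 0) :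
    φ.num.eval u ≠ 0 := by
  intro h0
  obtain ⟨a, b, hab⟩ := φ.isCoprime_num_denom
  have := congrArg (eval u) hab
  simp [h, h0] at this

/-- Numerator and denominator have no common zero at `∞`; after reflection this excludes a common
zero at `0`. The only delicate case is a zero numerator, where the denominator is a nonzero
constant. -/
theorem coeff_ratDegree_ne_zero (φ : RatFunc ℂ) (h : φ.denom.coeff (ratDegree φ) = 0) :
    φ.num.coeff (ratDegree φ) ≠ 0 := by
  rcases max_choice φ.num.natDegree φ.denom.natDegree with h1 | h1
  · rw [ratDegree, h1]
    intro h2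
    have h3 : φ.num = 0 := leadingCoeff_eq_zero.1 h2
    rw [ratDegree, h1, h3, natDegree_zero] at h
    rw [h3, natDegree_zero] at h1
    have h4 : φ.denom.natDegree = 0 := by simpa using h1
    rw [← h4] at h
    exact φ.denom_ne_zero (leadingCoeff_eq_zero.1 h)
  · rw [ratDegree, h1] at h
    exact absurd (leadingCoeff_eq_zero.1 h) φ.denom_ne_zero

theorem isCoprime_extNum_extDenom (φ : RatFunc ℂ) : IsCoprime (extNum φ) (extDenom φ) := by
  rw [isCoprime_iff_aeval_ne_zero_of_isAlgClosed ℂ ℂ]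
  intro u
  rw [coe_aeval_eq_eval]
  by_contra! h
  obtain ⟨h1, h2⟩ := h
  by_cases hu : u = 0
  · subst hu
    rw [extNum, eval_zero_conjReflect, map_eq_zero] at h1
    rw [extDenom, eval_zero_conjReflect, map_eq_zero] at h2
    exact coeff_ratDegree_ne_zero φ h1 h2
  · rw [extNum, eval_conjReflect (natDegree_denom_le φ) hu, mul_eq_zero,
      or_iff_right (pow_ne_zero _ hu), map_eq_zero] at h1
    rw [extDenom, eval_conjReflect (natDegree_num_le φ) hu, mul_eq_zero,
      or_iff_right (pow_ne_zero _ hu), map_eq_zero] at h2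
    exact eval_num_denom_ne_zero φ h1 h2

theorem natDegree_extNum_le (φ : RatFunc ℂ) : (extNum φ).natDegree ≤ ratDegree φ :=
  natDegree_conjReflect_le (natDegree_denom_le φ)

theorem natDegree_extDenom_le (φ : RatFunc ℂ) : (extDenom φ).natDegree ≤ ratDegree φ :=
  natDegree_conjReflect_le (natDegree_num_le φ)

theorem coeff_extNum (φ : RatFunc ℂ) :
    (extNum φ).coeff (ratDegree φ) = starRingEnd ℂ (φ.denom.eval 0) := by
  rw [extNum, coeff_conjReflect le_rfl, Nat.sub_self, coeff_zero_eq_eval_zero]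

theorem coeff_extDenom (φ : RatFunc ℂ) :
    (extDenom φ).coeff (ratDegree φ) = starRingEnd ℂ (φ.num.eval 0) := by
  rw [extDenom, coeff_conjReflect le_rfl, Nat.sub_self, coeff_zero_eq_eval_zero]

theorem max_natDegree_ext {φ : RatFunc ℂ} (h0 : φ.denom.eval 0 ≠ 0) :
    max (extNum φ).natDegree (extDenom φ).natDegree = ratDegree φ := by
  refine le_antisymm (max_le (natDegree_extNum_le φ) (natDegree_extDenom_le φ)) ?_
  refine le_max_of_le_left (le_natDegree_of_ne_zero ?_)
  rw [coeff_extNum]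
  simpa using h0

/-- Off `0` and `∞` the factor `u ^ d` produced by reflection cancels. At those two points the
coefficients of degrees `0` and `d` exchange roles. -/
theorem exteriorMap_eq {φ : RatFunc ℂ} (h0 : φ.denom.eval 0 ≠ 0) :
    exteriorMap φ = sphereMap (extNum φ) (extDenom φ) := by
  have hS : ∀ (p q : ℂ[X]) (u : ℂ), sphereMap p q (u : OnePoint ℂ) =
      if q.eval u = 0 then OnePoint.infty else ((p.eval u / q.eval u : ℂ) : OnePoint ℂ) :=
    fun _ _ _ => rfl
  have hI : ∀ u : ℂ, inversion (u : OnePoint ℂ) =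
      if u = 0 then OnePoint.infty else ((1 / starRingEnd ℂ u : ℂ) : OnePoint ℂ) := fun _ => rfl
  have hI' : inversion OnePoint.infty = ((0 : ℂ) : OnePoint ℂ) := rfl
  have hSi : ∀ p q : ℂ[X], sphereMap p q OnePoint.infty =
      if q.coeff (max p.natDegree q.natDegree) = 0 then OnePoint.infty
      else ((p.coeff (max p.natDegree q.natDegree) /
        q.coeff (max p.natDegree q.natDegree) : ℂ) : OnePoint ℂ) := fun _ _ => rfl
  funext x
  simp only [exteriorMap, Function.comp_apply]
  induction x using OnePoint.rec with
  | infty =>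
    rw [hI', hS, if_neg h0, hI, hSi, max_natDegree_ext h0, coeff_extNum, coeff_extDenom]
    by_cases hN : φ.num.eval 0 = 0
    · rw [hN, zero_div, map_zero, if_pos rfl, if_pos rfl]
    · rw [if_neg (div_ne_zero hN h0), if_neg (by simpa using hN), map_div₀, one_div_div]
  | coe u =>
    by_cases hu : u = 0
    · subst hu
      rw [hI, if_pos rfl, hSi, hS, extNum, extDenom, eval_zero_conjReflect, eval_zero_conjReflect]
      change inversion (if φ.denom.coeff (ratDegree φ) = 0 then OnePoint.infty else
        ((φ.num.coeff (ratDegree φ) / φ.denom.coeff (ratDegree φ) : ℂ) : OnePoint ℂ)) = _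
      by_cases hD : φ.denom.coeff (ratDegree φ) = 0
      · rw [if_pos hD, hI', if_neg (by simpa using coeff_ratDegree_ne_zero φ hD), hD, map_zero,
          zero_div]
      · rw [if_neg hD, hI]
        by_cases hN : φ.num.coeff (ratDegree φ) = 0
        · rw [hN, zero_div, map_zero, if_pos rfl, if_pos rfl]
        · rw [if_neg (div_ne_zero hN hD), if_neg (by simpa using hN), map_div₀, one_div_div]
    · rw [hI, if_neg hu, hS, hS, extNum, extDenom, eval_conjReflect (natDegree_denom_le φ) hu,
        eval_conjReflect (natDegree_num_le φ) hu]
      set y := 1 / starRingEnd ℂ u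
      have hud : u ^ ratDegree φ ≠ 0 := pow_ne_zero _ hu
      by_cases hD : φ.denom.eval y = 0
      · have hN := eval_num_denom_ne_zero φ hD
        rw [if_pos hD, hI', if_neg (mul_ne_zero hud (by simpa using hN)), hD, map_zero, mul_zero,
          zero_div]
      · rw [if_neg hD, hI]
        by_cases hN : φ.num.eval y = 0
        · rw [hN, zero_div, map_zero, mul_zero, if_pos rfl, if_pos rfl]
        · rw [if_neg (div_ne_zero hN hD), if_neg (mul_ne_zero hud (by simpa using hN)), map_div₀,
            one_div_div, mul_div_mul_left _ _ hud]

theorem isRationalOfDegree_exteriorMap {φ : RatFunc ℂ} (h0 : φ.denom.eval 0 ≠ 0) :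
    IsRationalOfDegree (exteriorMap φ) (ratDegree φ) :=
  ⟨_, _, isCoprime_extNum_extDenom φ, exteriorMap_eq h0, max_natDegree_ext h0⟩

theorem natDegree_fiberPoly_le (φ : RatFunc ℂ) (w : ℂ) :
    (fiberPoly φ w).natDegree ≤ ratDegree φ :=
  (natDegree_sub_le _ _).trans (max_le (natDegree_extNum_le φ)
    ((natDegree_C_mul_le _ _).trans (natDegree_extDenom_le φ)))

theorem eval_fiberPoly (φ : RatFunc ℂ) (w u : ℂ) :
    (fiberPoly φ w).eval u = (extNum φ).eval u - w * (extDenom φ).eval u := by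
  rw [fiberPoly, eval_sub, eval_mul, eval_C]

theorem eval_fiberPoly_of_ne_zero (φ : RatFunc ℂ) (w : ℂ) {u : ℂ} (hu : u ≠ 0) :
    (fiberPoly φ w).eval u = u ^ ratDegree φ *
      starRingEnd ℂ (φ.denom.eval (1 / starRingEnd ℂ u)
        - starRingEnd ℂ w * φ.num.eval (1 / starRingEnd ℂ u)) := by
  rw [eval_fiberPoly, extNum, extDenom, eval_conjReflect (natDegree_denom_le φ) hu,
    eval_conjReflect (natDegree_num_le φ) hu, map_sub, map_mul, Complex.conj_conj]
  ring

theorem coeff_fiberPoly (φ : RatFunc ℂ) (w : ℂ) : (fiberPoly φ w).coeff (ratDegree φ) =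
    starRingEnd ℂ (φ.denom.eval 0 - starRingEnd ℂ w * φ.num.eval 0) := by
  rw [fiberPoly, coeff_sub, coeff_C_mul, coeff_extNum, coeff_extDenom, map_sub, map_mul,
    Complex.conj_conj]

theorem extDenom_ne_zero_of_root {φ : RatFunc ℂ} {w u : ℂ} (h : (fiberPoly φ w).eval u = 0) :
    (extDenom φ).eval u ≠ 0 := by
  intro hq
  rw [eval_fiberPoly, hq, mul_zero, sub_zero] at h
  obtain ⟨a, b, hab⟩ := isCoprime_extNum_extDenom φ
  have := congrArg (eval u) hab
  simp [hq, h] at this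

namespace IsSelfMap

theorem differentiableOn {φ : RatFunc ℂ} (hφ : IsSelfMap φ) :
    DifferentiableOn ℂ (evalAt φ) unitDisc := by
  have h : evalAt φ = fun z => φ.num.eval z / φ.denom.eval z := funext (evalAt_eq φ)
  rw [h]
  exact φ.num.differentiableOn.div φ.denom.differentiableOn fun z hz => (hφ z hz).1

theorem mapsTo {φ : RatFunc ℂ} (hφ : IsSelfMap φ) : Set.MapsTo (evalAt φ) unitDisc unitDisc :=
  fun z hz => (hφ z hz).2

theorem denom_zero {φ : RatFunc ℂ} (hφ : IsSelfMap φ) : φ.denom.eval 0 ≠ 0 :=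
  (hφ 0 zero_mem_unitDisc).1

/-- The inequality, written without division, is a closed condition, so it passes from the disc to
its closure. -/
theorem norm_num_le {φ : RatFunc ℂ} (hφ : IsSelfMap φ) {u : ℂ} (hu : ‖u‖ ≤ 1) :
    ‖φ.num.eval u‖ ≤ ‖φ.denom.eval u‖ := by
  have hclosed : IsClosed {u : ℂ | ‖φ.num.eval u‖ ≤ ‖φ.denom.eval u‖} :=
    isClosed_le φ.num.continuous.norm φ.denom.continuous.norm
  have hsub : unitDisc ⊆ {u : ℂ | ‖φ.num.eval u‖ ≤ ‖φ.denom.eval u‖} := fun v hv => by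
    obtain ⟨h1, h2⟩ := hφ v hv
    rw [mem_unitDisc, evalAt_eq, norm_div, div_lt_one (norm_pos_iff.2 h1)] at h2
    exact h2.le
  refine closure_minimal hsub hclosed ?_
  rw [unitDisc, closure_ball _ one_ne_zero]
  simpa using hu

/-- A zero would force numerator and denominator to vanish together, against coprimality. Used with
`w = conj z`, it shows that no preimage of `z` is `∞` or lies outside the open disc. -/
theorem denom_sub_ne_zero {φ : RatFunc ℂ} (hφ : IsSelfMap φ) {w u : ℂ} (hw : ‖w‖ < 1)
    (hu : ‖u‖ ≤ 1) : φ.denom.eval u - w * φ.num.eval u ≠ 0 := by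
  intro h
  have h1 := hφ.norm_num_le hu
  have h2 : ‖φ.denom.eval u‖ = ‖w‖ * ‖φ.num.eval u‖ := by rw [sub_eq_zero.1 h, norm_mul]
  have h3 : ‖φ.denom.eval u‖ = 0 := by
    nlinarith [norm_nonneg w, norm_nonneg (φ.denom.eval u), norm_nonneg (φ.num.eval u)]
  exact eval_num_denom_ne_zero φ (norm_eq_zero.1 h3)
    (norm_eq_zero.1 (le_antisymm (h3 ▸ h1) (norm_nonneg _)))

theorem coeff_fiberPoly_ne_zero {φ : RatFunc ℂ} (hφ : IsSelfMap φ) {w : ℂ} (hw : w ∈ unitDisc) :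
    (fiberPoly φ w).coeff (ratDegree φ) ≠ 0 := by
  rw [coeff_fiberPoly, Ne, map_eq_zero]
  exact hφ.denom_sub_ne_zero (by simpa using mem_unitDisc.1 hw) (by simp)

/-- The exterior map sends the complement of the unit disc to itself. -/
theorem root_mem_unitDisc {φ : RatFunc ℂ} (hφ : IsSelfMap φ) {w s : ℂ} (hw : w ∈ unitDisc)
    (hs : (fiberPoly φ w).eval s = 0) : s ∈ unitDisc := by
  rw [mem_unitDisc] at *
  by_contra! h
  have hs0 : s ≠ 0 := norm_pos_iff.1 (by linarith)
  rw [eval_fiberPoly_of_ne_zero φ w hs0, mul_eq_zero, or_iff_right (pow_ne_zero _ hs0),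
    map_eq_zero] at hs
  refine hφ.denom_sub_ne_zero (by simpa using hw) ?_ hs
  rw [norm_div, norm_one, RCLike.norm_conj]
  exact (div_le_one (by linarith)).2 h

theorem preimage_exteriorMap {φ : RatFunc ℂ} (hφ : IsSelfMap φ) {w : ℂ} (hw : w ∈ unitDisc) :
    exteriorMap φ ⁻¹' {(w : OnePoint ℂ)} =
      (fun u : ℂ => (u : OnePoint ℂ)) '' {u | (fiberPoly φ w).eval u = 0} := by
  rw [exteriorMap_eq hφ.denom_zero]
  refine preimage_sphereMap_coe (isCoprime_extNum_extDenom φ) ?_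
  rw [max_natDegree_ext hφ.denom_zero]
  exact hφ.coeff_fiberPoly_ne_zero hw

theorem exteriorMap_coe_eq_coe_iff {φ : RatFunc ℂ} (hφ : IsSelfMap φ) (u w : ℂ) :
    exteriorMap φ (u : OnePoint ℂ) = (w : OnePoint ℂ) ↔ (fiberPoly φ w).eval u = 0 := by
  rw [exteriorMap_eq hφ.denom_zero]
  exact sphereMap_coe_eq_coe_iff (isCoprime_extNum_extDenom φ) u w

theorem exists_enumeration {φ : RatFunc ℂ} (hφ : IsSelfMap φ) {w : ℂ} (hw : w ∈ unitDisc)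
    (hreg : IsRegularValue (exteriorMap φ) (w : OnePoint ℂ)) :
    ∃ v : Fin (ratDegree φ) → ℂ, Function.Injective v ∧
      ∀ u, (fiberPoly φ w).eval u = 0 ↔ ∃ j, v j = u := by
  obtain ⟨d, hd, hcard⟩ := hreg
  -- `IsRegularValue` carries its own degree; uniqueness identifies it with `ratDegree φ`.
  rw [hd.unique (isRationalOfDegree_exteriorMap hφ.denom_zero), hφ.preimage_exteriorMap hw,
    OnePoint.coe_injective.encard_image] at hcard
  exact exists_enumeration_of_encard_roots hcard

end IsSelfMap

/-! ### Branches of the inverse -/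

/-- In the quotient rule substitute `extNum = w * extDenom` at `s`; one factor of `extDenom`
cancels. -/
theorem hasStrictDerivAt_ext {φ : RatFunc ℂ} {w s : ℂ} (hs : (fiberPoly φ w).eval s = 0) :
    HasStrictDerivAt (fun u => (extNum φ).eval u / (extDenom φ).eval u)
      ((fiberPoly φ w).derivative.eval s / (extDenom φ).eval s) s := by
  have hq := extDenom_ne_zero_of_root hs
  have h := ((extNum φ).hasStrictDerivAt s).div ((extDenom φ).hasStrictDerivAt s) hq
  refine h.congr_deriv ?_
  rw [eval_fiberPoly, sub_eq_zero] at hs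
  rw [hs, fiberPoly, derivative_sub, derivative_C_mul, eval_sub, eval_mul, eval_C]
  field_simp

theorem div_eq_of_root {φ : RatFunc ℂ} {w s : ℂ} (hs : (fiberPoly φ w).eval s = 0) :
    (extNum φ).eval s / (extDenom φ).eval s = w := by
  rw [div_eq_iff (extDenom_ne_zero_of_root hs)]
  rwa [eval_fiberPoly, sub_eq_zero] at hs

theorem exists_local_branch {φ : RatFunc ℂ} {w s : ℂ} (hs : (fiberPoly φ w).eval s = 0)
    (hs' : (fiberPoly φ w).derivative.eval s ≠ 0) :
    ∃ σ : ℂ → ℂ, σ w = s ∧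
      ∀ᶠ x in 𝓝 w, DifferentiableAt ℂ σ x ∧ (fiberPoly φ x).eval (σ x) = 0 := by
  have hq := extDenom_ne_zero_of_root hs
  have hd := hasStrictDerivAt_ext hs
  have hd0 := div_ne_zero hs' hq
  have hw := div_eq_of_root hs
  have hR : AnalyticAt ℂ (fun u => (extNum φ).eval u / (extDenom φ).eval u) s :=
    ((extNum φ).differentiable.analyticAt s).div ((extDenom φ).differentiable.analyticAt s) hq
  have hder : deriv (fun u => (extNum φ).eval u / (extDenom φ).eval u) s ≠ 0 := by
    rw [hd.hasDerivAt.deriv]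
    exact hd0
  have han := hR.analyticAt_localInverse hder
  have hstr := hR.hasStrictDerivAt
  set σ := hstr.localInverse _ _ s hder with hσ
  have hσw : σ w = s := by
    have h := (hstr.eventually_left_inverse hder).self_of_nhds
    simp only [hw] at h
    exact h
  simp only [hw] at han
  refine ⟨σ, hσw, ?_⟩
  have h1 := hstr.eventually_right_inverse hder
  simp only [hw] at h1
  -- Needed to clear the denominator in the right-inverse identity, since division by zero yields
  -- `0`.
  have h2 : ∀ᶠ x in 𝓝 w, (extDenom φ).eval (σ x) ≠ 0 := by
    have hc : ContinuousAt (fun x => (extDenom φ).eval (σ x)) w :=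
      (extDenom φ).continuous.continuousAt.comp han.continuousAt
    exact hc.eventually_ne (by rw [hσw]; exact hq)
  filter_upwards [han.eventually_analyticAt, h1, h2] with x hx1 hx2 hx3
  refine ⟨hx1.differentiableAt, ?_⟩
  rw [eval_fiberPoly, sub_eq_zero]
  exact (div_eq_iff hx3).1 hx2

theorem IsSelfMap.exists_branchSystem {φ : RatFunc ℂ} (hφ : IsSelfMap φ) {z : ℂ}
    (hz : z ∈ unitDisc) (hreg : IsRegularValue (exteriorMap φ) (z : OnePoint ℂ)) :
    ∃ (V : Set ℂ) (σ : Fin (ratDegree φ) → ℂ → ℂ),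
      IsBranchSystem (exteriorMap φ) (ratDegree φ) z V σ := by
  obtain ⟨v, hv, hroot⟩ := hφ.exists_enumeration hz hreg
  have hr : ∀ j, (fiberPoly φ z).eval (v j) = 0 := fun j => (hroot _).2 ⟨j, rfl⟩
  choose σ hσz hσ using fun j => exists_local_branch (hr j)
    (eval_derivative_ne_zero (natDegree_fiberPoly_le φ z) (hφ.coeff_fiberPoly_ne_zero hz) hv hr j)
  obtain ⟨ε, hε, hball⟩ := Metric.eventually_nhds_iff_ball.1
    ((eventually_all.2 hσ).and (isOpen_unitDisc.mem_nhds hz))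
  refine ⟨Metric.ball z ε, σ, ⟨Metric.isOpen_ball,
    (convex_ball z ε).isConnected ⟨z, Metric.mem_ball_self hε⟩,
    fun x hx => (hball x hx).2, Metric.mem_ball_self hε, fun j =>
      ⟨fun x hx => ((hball x hx).1 j).1.differentiableWithinAt, fun x hx => ?_⟩, ?_⟩⟩
  · exact (hφ.exteriorMap_coe_eq_coe_iff _ _).2 ((hball x hx).1 j).2
  · intro i j hij h
    have h1 := h (Metric.mem_ball_self hε)
    rw [hσz, hσz] at h1
    exact hij (hv h1)

/-- Distinct branches are only assumed to differ somewhere on `V`. If two agreed at `z`, both would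
coincide near `z` with the local inverse there, hence on all of the connected set `V` by the
identity theorem. -/
theorem IsSelfMap.branchSystem_injective {φ : RatFunc ℂ} (hφ : IsSelfMap φ) {z : ℂ}
    {V : Set ℂ} {σ : Fin (ratDegree φ) → ℂ → ℂ}
    (hB : IsBranchSystem (exteriorMap φ) (ratDegree φ) z V σ)
    (hsimple : ∀ s, (fiberPoly φ z).eval s = 0 → (fiberPoly φ z).derivative.eval s ≠ 0) :
    Function.Injective fun j => σ j z := by
  intro i j hij
  by_contra hne
  have hroot : ∀ k, ∀ x ∈ V, (fiberPoly φ x).eval (σ k x) = 0 := fun k x hx =>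
    (hφ.exteriorMap_coe_eq_coe_iff _ _).1 ((hB.branch k).2 x hx)
  have hs := hroot i z hB.mem
  have hd := hasStrictDerivAt_ext hs
  have hd0 := div_ne_zero (hsimple _ hs) (extDenom_ne_zero_of_root hs)
  have hleft := hd.eventually_left_inverse hd0
  have hV : V ∈ 𝓝 z := hB.isOpen.mem_nhds hB.mem
  have key : ∀ k, σ k z = σ i z → ∀ᶠ x in 𝓝 z,
      hd.localInverse _ _ _ hd0 x = σ k x := fun k hk => by
    have hc : Tendsto (σ k) (𝓝 z) (𝓝 (σ i z)) :=
      hk ▸ ((hB.branch k).1.differentiableAt hV).continuousAt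
    filter_upwards [hc.eventually hleft, hV] with x hx hxV
    rwa [div_eq_of_root (hroot k x hxV)] at hx
  have heq : σ i =ᶠ[𝓝 z] σ j := by
    filter_upwards [key i rfl, key j hij.symm] with x h1 h2
    rw [← h1, h2]
  exact hB.distinct i j hne (AnalyticOnNhd.eqOn_of_preconnected_of_eventuallyEq
    ((hB.branch i).1.analyticOnNhd hB.isOpen) ((hB.branch j).1.analyticOnNhd hB.isOpen)
    hB.isConnected.isPreconnected hB.mem heq)

/-- Implicit differentiation of `extNum (σ x) = x * extDenom (σ x)`. -/
theorem IsSelfMap.deriv_branch {φ : RatFunc ℂ} (hφ : IsSelfMap φ) {z : ℂ} {V : Set ℂ}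
    (hV : V ∈ 𝓝 z) {σ : ℂ → ℂ} (hσ : IsBranch (exteriorMap φ) V σ)
    (hsimple : (fiberPoly φ z).derivative.eval (σ z) ≠ 0) :
    deriv σ z = (extDenom φ).eval (σ z) / (fiberPoly φ z).derivative.eval (σ z) := by
  have hd : HasDerivAt σ (deriv σ z) z := (hσ.1.differentiableAt hV).hasDerivAt
  have h1 : HasDerivAt (fun x => (extNum φ).eval (σ x))
      ((extNum φ).derivative.eval (σ z) * deriv σ z) z :=
    ((extNum φ).hasDerivAt (σ z)).comp z hd
  have h2 : HasDerivAt (fun x => (extDenom φ).eval (σ x))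
      ((extDenom φ).derivative.eval (σ z) * deriv σ z) z :=
    ((extDenom φ).hasDerivAt (σ z)).comp z hd
  have h3 := (hasDerivAt_id' z).mul h2
  have heq : (fun x => (extNum φ).eval (σ x)) =ᶠ[𝓝 z]
      (fun x => x) * fun x => (extDenom φ).eval (σ x) := by
    filter_upwards [hV] with x hx
    have h4 := (hφ.exteriorMap_coe_eq_coe_iff _ _).1 (hσ.2 x hx)
    rw [eval_fiberPoly, sub_eq_zero] at h4
    exact h4
  have h5 := h1.unique (h3.congr_of_eventuallyEq heq)
  rw [eq_div_iff hsimple, fiberPoly, derivative_sub, derivative_C_mul, eval_sub, eval_mul, eval_C]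
  linear_combination h5

/-! ### The formula -/

/-- This is the partial fraction expansion of `extDenom φ / fiberPoly φ z` at the reflected point `1
/ conj u`, conjugated: `(1 / conj u - s)⁻¹` becomes `u / (1 - conj s * u)`. The point `u = 0` has no
finite reflection and is checked directly. -/
theorem IsSelfMap.num_div_eq {φ : RatFunc ℂ} (hφ : IsSelfMap φ) {z : ℂ} (hz : z ∈ unitDisc)
    {s : Fin (ratDegree φ) → ℂ} (hinj : Function.Injective s)
    (hs : ∀ j, (fiberPoly φ z).eval (s j) = 0) {u : ℂ} (hu : u ∈ unitDisc) :
    φ.num.eval u / (φ.denom.eval u - starRingEnd ℂ z * φ.num.eval u) =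
      φ.num.eval 0 / (φ.denom.eval 0 - starRingEnd ℂ z * φ.num.eval 0) +
      ∑ j, starRingEnd ℂ ((extDenom φ).eval (s j) / (fiberPoly φ z).derivative.eval (s j)) *
        (u / (1 - starRingEnd ℂ (s j) * u)) := by
  by_cases hu0 : u = 0
  · subst hu0
    simp
  have hx0 : 1 / starRingEnd ℂ u ≠ 0 := one_div_ne_zero (by simpa using hu0)
  have hxu : 1 / starRingEnd ℂ (1 / starRingEnd ℂ u) = u := by simp
  have hxs : ∀ j, 1 / starRingEnd ℂ u ≠ s j := fun j h => by
    have h1 := mem_unitDisc.1 (hφ.root_mem_unitDisc hz (hs j))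
    rw [← h, norm_div, norm_one, RCLike.norm_conj, div_lt_one (norm_pos_iff.2 hu0)] at h1
    exact absurd (mem_unitDisc.1 hu) h1.not_gt
  have h := eval_div_eval_eq (natDegree_fiberPoly_le φ z) (hφ.coeff_fiberPoly_ne_zero hz)
    (natDegree_extDenom_le φ) hinj hs hxs
  rw [eval_fiberPoly_of_ne_zero φ z hx0, coeff_fiberPoly, coeff_extDenom] at h
  conv at h => lhs; rw [extDenom, eval_conjReflect (natDegree_num_le φ) hx0]
  rw [hxu, mul_div_mul_left _ _ (pow_ne_zero _ hx0)] at h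
  have h2 := congrArg (starRingEnd ℂ) h
  rw [map_div₀, Complex.conj_conj, Complex.conj_conj, map_add, map_div₀, Complex.conj_conj,
    Complex.conj_conj, map_sum] at h2
  rw [h2]
  congr 1
  refine Finset.sum_congr rfl fun j _ => ?_
  rw [map_mul, map_inv₀, map_sub, map_div₀ _ 1, map_one, Complex.conj_conj]
  congr 1
  have h3 := H2.one_sub_conj_mul_ne_zero (hφ.root_mem_unitDisc hz (hs j)) hu
  have h4 : 1 / u - starRingEnd ℂ (s j) = (1 - starRingEnd ℂ (s j) * u) / u := by
    field_simp
  rw [h4, inv_div]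

theorem IsSelfMap.comp_shiftKernel {φ : RatFunc ℂ} (hφ : IsSelfMap φ) {C : H2 →L[ℂ] H2}
    (hC : ∀ (f : H2), ∀ z ∈ unitDisc, C f z = f (evalAt φ z)) {z : ℂ} (hz : z ∈ unitDisc)
    {s : Fin (ratDegree φ) → ℂ} (hinj : Function.Injective s)
    (hs : ∀ j, (fiberPoly φ z).eval (s j) = 0) :
    C (H2.shiftKernel hz) =
      (φ.num.eval 0 / (φ.denom.eval 0 - starRingEnd ℂ z * φ.num.eval 0)) • H2.one +
      ∑ j, starRingEnd ℂ ((extDenom φ).eval (s j) / (fiberPoly φ z).derivative.eval (s j)) •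
        H2.shiftKernel (hφ.root_mem_unitDisc hz (hs j)) := by
  refine H2.ext fun u hu => ?_
  rw [hC _ u hu, H2.shiftKernel_apply hz (hφ u hu).2, H2.add_apply, H2.sum_apply, H2.smul_apply,
    H2.one_apply hu, mul_one]
  simp only [H2.smul_apply, H2.shiftKernel_apply _ hu]
  rw [← hφ.num_div_eq hz hinj hs hu, evalAt_eq]
  have h1 := (hφ u hu).1
  have h2 := hφ.denom_sub_ne_zero (w := starRingEnd ℂ z) (by simpa using mem_unitDisc.1 hz)
    (mem_unitDisc.1 hu).le
  have h3 : 1 - starRingEnd ℂ z * (φ.num.eval u / φ.denom.eval u) =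
      (φ.denom.eval u - starRingEnd ℂ z * φ.num.eval u) / φ.denom.eval u := by
    field_simp
  rw [h3, div_div_div_cancel_right₀ h1]

/-- Evaluation at `0` is pairing with the constant `1`, which `C` fixes. -/
theorem adjoint_apply_zero {φ : ℂ → ℂ} (hm : Set.MapsTo φ unitDisc unitDisc) {C : H2 →L[ℂ] H2}
    (hC : ∀ (f : H2), ∀ z ∈ unitDisc, C f z = f (φ z)) (f : H2) :
    ContinuousLinearMap.adjoint C f 0 = f 0 := by
  have h : C H2.one = H2.one := H2.ext fun z hz => by
    rw [hC _ z hz, H2.one_apply hz, H2.one_apply (hm hz)]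
  rw [← H2.inner_one, ContinuousLinearMap.adjoint_inner_right, h, H2.inner_one]

end RationalComposition

/-- `C` is the composition operator `C_φ` on `H²`, `C.adjoint` is its adjoint, `Ω` is the operator
`Ω_φ`, and `d` is the degree of the exterior map. The operators `C` and `Ω` and the number `d` are
uniquely determined by the conditions on them. -/
theorem proposition3p1 (φ : RatFunc ℂ) (hφ : IsSelfMap φ) :
    ∃ d : ℕ, IsRationalOfDegree (exteriorMap φ) d ∧
    ∃ C : H2 →L[ℂ] H2, (∀ (f : H2), ∀ z ∈ unitDisc, C f z = f (evalAt φ z)) ∧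
    ∃ Ω : H20 →L[ℂ] H2,
      (∀ (f : H20), ∀ z ∈ unitDisc, ContinuousLinearMap.adjoint C f z = z * Ω f z) ∧
      ∀ z ∈ unitDisc, IsRegularValue (exteriorMap φ) (z : OnePoint ℂ) →
        (∃ (V : Set ℂ) (σ : Fin d → ℂ → ℂ), IsBranchSystem (exteriorMap φ) d z V σ) ∧
        ∀ (V : Set ℂ) (σ : Fin d → ℂ → ℂ), IsBranchSystem (exteriorMap φ) d z V σ →
          ∀ f : H20, Ω f z = ∑ j, deriv (σ j) z * backwardShift f (σ j z) := by
  have hC : ∀ (f : H2), ∀ z ∈ unitDisc,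
      compositionOperator hφ.differentiableOn hφ.mapsTo f z = f (evalAt φ z) :=
    fun f z hz => compositionOperator_apply hφ.differentiableOn hφ.mapsTo f hz
  set C := compositionOperator hφ.differentiableOn hφ.mapsTo
  have hf0 : ∀ f : H20, (f : H2) 0 = 0 := fun f => f.2
  refine ⟨ratDegree φ, isRationalOfDegree_exteriorMap hφ.denom_zero, C, hC,
    (H2.shift.comp (ContinuousLinearMap.adjoint C)).comp H20.subtypeL, fun f z hz => ?_,
    fun z hz hreg => ⟨hφ.exists_branchSystem hz hreg, fun V σ hB f => ?_⟩⟩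
  · change _ = z * H2.shift (ContinuousLinearMap.adjoint C f) z
    rw [H2.apply_eq_add_shift _ hz, adjoint_apply_zero hφ.mapsTo hC, hf0, zero_add]
  · change H2.shift (ContinuousLinearMap.adjoint C f) z = _
    have hV : V ∈ nhds z := hB.isOpen.mem_nhds hB.mem
    have hs : ∀ j, (fiberPoly φ z).eval (σ j z) = 0 := fun j =>
      (hφ.exteriorMap_coe_eq_coe_iff _ _).1 ((hB.branch j).2 z hB.mem)
    -- Regularity gives `d` distinct roots of a polynomial of degree `d`, so all are simple.
    have hsimple : ∀ s, (fiberPoly φ z).eval s = 0 →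
        (fiberPoly φ z).derivative.eval s ≠ 0 := fun s hs => by
      obtain ⟨v, hv, hroot⟩ := hφ.exists_enumeration hz hreg
      obtain ⟨j, rfl⟩ := (hroot s).1 hs
      exact eval_derivative_ne_zero (natDegree_fiberPoly_le φ z) (hφ.coeff_fiberPoly_ne_zero hz)
        hv (fun j => (hroot _).2 ⟨j, rfl⟩) j
    -- The constant term of `C k_z` pairs with `f` to a multiple of `f 0 = 0`. Conjugate-linearity
    -- in the first slot undoes the conjugates on the remaining coefficients.
    rw [← H2.inner_shiftKernel hz, ContinuousLinearMap.adjoint_inner_right,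
      hφ.comp_shiftKernel hC hz (hφ.branchSystem_injective hB hsimple) hs, inner_add_left,
      inner_smul_left, H2.inner_one, hf0, mul_zero, zero_add, sum_inner]
    refine Finset.sum_congr rfl fun j _ => ?_
    rw [inner_smul_left, Complex.conj_conj, H2.inner_shiftKernel,
      H2.shift_apply _ (hφ.root_mem_unitDisc hz (hs j)),
      hφ.deriv_branch hV (hB.branch j) (hsimple _ (hs j))]
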